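/- Let $L$ be a finite-dimensional real nilpotent Lie algebra with lower central series $L=L_1\supset L_2\supset\cdots$, $L_{k+1}=[L,L_k]$, and let $L=\bigoplus_{k\ge 1}R_k$ be a grading of $L$: $R_k\subset L_k$, $L_k=R_k\oplus L_{k+1}$ and $[R_i,R_j]\subset R_{i+j}$. Let $N$ be the connected and simply connected Lie group with Lie algebra $L$, written in exponential coordinates $a=\sum_k a_k$ ($a_k\in R_k$), i.e. $N=L$ with the Baker–Campbell–Hausdorff product. The group $\mathbb R^*_+$ acts on $N$ by the automorphisms $a\mapsto a^r=\sum_k r^k a_k$; let $G=\mathbb R^*_+\ltimes N$ be the semidirect product in which $r\,a\,r^{-1}=a^r$. For a unitary (strongly continuous) representation $T$ of $N$ in a complex Hilbert space $H$ put $T_r(a)=T(a^r)$, and let $\widetilde T$ be the representation of $G$ in $\int_0^\infty H\,d^*r=L^2(\mathbb R^*_+,d^*r;H)$, $d^*r=r^{-1}dr$, given by $$(\widetilde T(a)f)(r)=T_r(a)f(r)\quad(a\in N),\qquad (\widetilde T(r_0)f)(r)=f(rr_0)\quad(r_0\in\mathbb R^*_+).$$ A unitary representation $\pi$ of a topological group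 is called special if it has a nontrivial 1-cocycle, i.e. a continuous map $\beta$ into the representation space with $\beta(g_1g_2)=\pi(g_1)\beta(g_2)+\beta(g_1)$ that is not of the form $\beta(g)=\pi(g)v-v$. Let $T$ be an irreducible unitary representation of $N$ in $H$ such that $H$ contains no nonzero $N$-invariant vector (that is, $T$ is not the trivial one-dimensional representation). Then: 1. $T$ is summable: for every smooth positive function $u$ on $(0,\infty)$ such that the measure $dm(r)=e^{-u(r)/2}d^*r$ is infinite and $m([\varepsilon,\infty))<\infty$ for all $\varepsilon>0$, no $T_r$ has a nonzero invariant vector and there is a nonzero $h\in H$ with $\int_0^\infty\|T_r(a)h-h\|\,dm(r)<\infty$ for every $a\in N$. 2. $\widetilde T$ is a special unitary representation of $G$. 3. $\widetilde T$ is irreducible. -/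

import Mathlib

open MeasureTheory
open scoped ContDiff

/-! The multiplicative group of positive reals and its Haar measure. -/

/-- The multiplicative group of positive real numbers. -/
abbrev PosReal : Type := {r : ℝ // 0 < r}

namespace PosReal

/-- The Haar measure `r⁻¹ dr`. -/
noncomputable def haar : Measure PosReal :=
  ((volume : Measure ℝ).comap Subtype.val).withDensity fun r => ENNReal.ofReal (r : ℝ)⁻¹

theorem lintegral_haar {f : PosReal → ENNReal} (hf : Measurable f) :
    ∫⁻ r, f r ∂haar =
      ∫⁻ x : ℝ, if h : 0 < x then ENNReal.ofReal x⁻¹ * f ⟨x, h⟩ else 0 := by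
  have hm : Measurable fun r : PosReal => ENNReal.ofReal (r : ℝ)⁻¹ :=
    (measurable_subtype_coe.inv).ennreal_ofReal
  rw [haar, lintegral_withDensity_eq_lintegral_mul _ hm hf]
  set F : ℝ → ENNReal := fun x => if h : 0 < x then ENNReal.ofReal x⁻¹ * f ⟨x, h⟩ else 0 with hF
  have h1 : ((fun r : PosReal => ENNReal.ofReal (r : ℝ)⁻¹) * f) = fun r : PosReal => F r := by
    funext r
    simp [hF, r.2]
  rw [h1]
  have h2 := lintegral_subtype_comap (μ := (volume : Measure ℝ)) (s := Set.Ioi 0)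
    measurableSet_Ioi F
  refine h2.trans ?_
  rw [← lintegral_indicator measurableSet_Ioi]
  congr 1
  funext x
  by_cases hx : 0 < x <;> simp [hF, hx, Set.indicator]

theorem measurePreserving_mul_right (s : PosReal) :
    MeasurePreserving (fun r : PosReal => r * s) haar haar := by
  have hmeas : Measurable fun r : PosReal => r * s :=
    Measurable.subtype_mk (measurable_subtype_coe.mul_const _)
  refine ⟨hmeas, Measure.ext_of_lintegral _ fun f hf => ?_⟩
  rw [lintegral_map hf hmeas, lintegral_haar (f := fun r => f (r * s)) (hf.comp hmeas),
    lintegral_haar hf]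
  set F : ℝ → ENNReal := fun x => if h : 0 < x then ENNReal.ofReal x⁻¹ * f ⟨x, h⟩ else 0 with hF
  have hs : (0 : ℝ) < s := s.2
  have h1 : ∀ x : ℝ, (if h : 0 < x then ENNReal.ofReal x⁻¹ * f (⟨x, h⟩ * s) else 0) =
      ENNReal.ofReal s * F (x * s) := by
    intro x
    by_cases hx : 0 < x
    · have hxs : 0 < x * s := mul_pos hx hs
      simp only [hF, hx, hxs, dif_pos]
      rw [← mul_assoc, ← ENNReal.ofReal_mul hs.le]
      congr 2
      field_simp
    · have hxs : ¬ 0 < x * s := fun h => hx (pos_of_mul_pos_left h hs.le)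
      simp [hF, hx, hxs]
  simp only [h1]
  rw [lintegral_const_mul' _ _ ENNReal.ofReal_ne_top]
  have h2 := Real.map_volume_mul_right hs.ne'
  have h3 : ∫⁻ x, F (x * s) = ∫⁻ y, F y ∂(Measure.map (· * (s : ℝ)) volume) :=
    (lintegral_map_equiv F (Homeomorph.mulRight₀ (s : ℝ) hs.ne').toMeasurableEquiv).symm
  rw [h3, h2, lintegral_smul_measure, abs_of_pos (inv_pos.2 hs), smul_eq_mul, ← mul_assoc,
    ← ENNReal.ofReal_mul hs.le, mul_inv_cancel₀ hs.ne']
  simp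

instance : LocallyCompactSpace PosReal :=
  (isOpen_Ioi (a := (0 : ℝ))).isOpenEmbedding_subtypeVal.locallyCompactSpace

instance : IsLocallyFiniteMeasure haar := by
  have h1 : IsLocallyFiniteMeasure
      ((volume : Measure ℝ).comap (Subtype.val : PosReal → ℝ)) := by
    refine ⟨fun x => ?_⟩
    obtain ⟨U, hU, hUf⟩ := (volume : Measure ℝ).finiteAt_nhds (x : ℝ)
    refine ⟨Subtype.val ⁻¹' U, continuous_subtype_val.continuousAt hU, ?_⟩
    refine ((MeasurableEmbedding.subtype_coe (s := Set.Ioi (0 : ℝ)) measurableSet_Ioi).comap_apply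
      volume (Subtype.val ⁻¹' U)).trans_lt ?_
    exact (measure_mono (Set.image_preimage_subset _ _)).trans_lt hUf
  exact IsLocallyFiniteMeasure.withDensity_ofReal
    (continuous_subtype_val.inv₀ fun r : PosReal => r.2.ne')

theorem continuous_mul_right (s : PosReal) : Continuous fun r : PosReal => r * s :=
  Continuous.subtype_mk (continuous_subtype_val.mul continuous_const) _

end PosReal

/-- A grading of a real nilpotent Lie algebra `L` with lower central series
`L = L₁ ⊇ L₂ ⊇ ⋯` (in Mathlib the series starts at index `0`, so that `L_{k+1}` is
`LieModule.lowerCentralSeries ℝ L L k`): subspaces `R₁, R₂, …` with `L = ⨁ R_k`, `R_k ⊆ L_k`,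
`L_k = R_k ⊕ L_{k+1}` and `[R_i, R_j] ⊆ R_{i+j}`.  The unused index `0` carries `⊥`; if `L` has
class `n`, then `R_k ⊆ L_k = 0` for `k > n`. -/
structure LieGrading (L : Type*) [LieRing L] [LieAlgebra ℝ L] where
  /-- The homogeneous components. -/
  R : ℕ → Submodule ℝ L
  R_zero : R 0 = ⊥
  isInternal : DirectSum.IsInternal R
  le_lcs : ∀ k, R (k + 1) ≤ (LieModule.lowerCentralSeries ℝ L L k).toSubmodule
  sup_lcs : ∀ k, R (k + 1) ⊔ (LieModule.lowerCentralSeries ℝ L L (k + 1)).toSubmodule =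
    (LieModule.lowerCentralSeries ℝ L L k).toSubmodule
  disjoint_lcs : ∀ k,
    Disjoint (R (k + 1)) (LieModule.lowerCentralSeries ℝ L L (k + 1)).toSubmodule
  lie_mem : ∀ i j : ℕ, ∀ x ∈ R i, ∀ y ∈ R j, ⁅x, y⁆ ∈ R (i + j)

namespace LieGrading

variable {L : Type*} [LieRing L] [LieAlgebra ℝ L] (𝒢 : LieGrading L)

theorem bijective : Function.Bijective (DirectSum.coeLinearMap 𝒢.R) := 𝒢.isInternal

/-- The projection `a ↦ a_k` onto the component `R_k`. -/
noncomputable def proj (k : ℕ) : L →ₗ[ℝ] L :=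
  (𝒢.R k).subtype ∘ₗ DirectSum.component ℝ ℕ (fun i => 𝒢.R i) k ∘ₗ
    (LinearEquiv.ofBijective (DirectSum.coeLinearMap 𝒢.R) 𝒢.bijective).symm.toLinearMap

theorem proj_mem (k : ℕ) (x : L) : 𝒢.proj k x ∈ 𝒢.R k := by
  simp only [proj, LinearMap.comp_apply, Submodule.subtype_apply, SetLike.coe_mem]

theorem proj_of_mem {j k : ℕ} {x : L} (hx : x ∈ 𝒢.R j) :
    𝒢.proj k x = if k = j then x else 0 := by
  have h : (LinearEquiv.ofBijective (DirectSum.coeLinearMap 𝒢.R) 𝒢.bijective).symm x =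
      DirectSum.lof ℝ ℕ (fun i => 𝒢.R i) j ⟨x, hx⟩ := by
    rw [LinearEquiv.symm_apply_eq]
    simp
  simp only [proj, LinearMap.comp_apply, LinearEquiv.coe_coe, h]
  by_cases hk : k = j
  · subst hk
    simp [DirectSum.component.lof_self]
  · rw [DirectSum.component.of]
    simp [hk, Ne.symm hk]

theorem ext_mem {M : Type*} [AddCommGroup M] [Module ℝ M] {f g : L →ₗ[ℝ] M}
    (h : ∀ k, ∀ x ∈ 𝒢.R k, f x = g x) : f = g := by
  have htop := 𝒢.isInternal.submodule_iSup_eq_top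
  have : (⨆ i, 𝒢.R i) ≤ LinearMap.eqLocus f g := iSup_le fun i x hx => h i x hx
  rw [htop] at this
  ext x
  exact this (Submodule.mem_top (x := x))

theorem lie_ext {M : Type*} [AddCommGroup M] [Module ℝ M] {f g : L →ₗ[ℝ] L →ₗ[ℝ] M}
    (h : ∀ i, ∀ x ∈ 𝒢.R i, ∀ j, ∀ y ∈ 𝒢.R j, f x y = g x y) : f = g :=
  𝒢.ext_mem fun i x hx => 𝒢.ext_mem fun j y hy => h i x hx j y hy

theorem proj_zero (x : L) : 𝒢.proj 0 x = 0 := by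
  have h := 𝒢.proj_mem 0 x
  rwa [𝒢.R_zero, Submodule.mem_bot] at h

/-- The elements of `L` all of whose components of degree below `k` vanish. -/
noncomputable def tail (k : ℕ) : Submodule ℝ L := ⨅ j : Fin k, LinearMap.ker (𝒢.proj j)

theorem mem_tail {k : ℕ} {x : L} : x ∈ 𝒢.tail k ↔ ∀ j < k, 𝒢.proj j x = 0 := by
  simp [tail, Submodule.mem_iInf, Fin.forall_iff]

theorem mem_tail_one (x : L) : x ∈ 𝒢.tail 1 := by
  rw [mem_tail]
  intro j hj
  obtain rfl : j = 0 := by omega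
  exact 𝒢.proj_zero x

theorem tail_anti {j k : ℕ} (h : j ≤ k) {x : L} (hx : x ∈ 𝒢.tail k) : x ∈ 𝒢.tail j := by
  rw [mem_tail] at *
  exact fun i hi => hx i (by omega)

/-- The class of `L`. -/
noncomputable def cls (_ : LieGrading L) : ℕ := LieModule.nilpotencyLength L L

variable [LieRing.IsNilpotent L]

theorem R_eq_bot {k : ℕ} (hk : 𝒢.cls < k) : 𝒢.R k = ⊥ := by
  obtain ⟨m, rfl⟩ : ∃ m, k = m + 1 := ⟨k - 1, by omega⟩
  have hm : 𝒢.cls ≤ m := by omega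
  have h : LieModule.lowerCentralSeries ℝ L L 𝒢.cls = ⊥ := by
    have h1 : ∃ k, LieModule.lowerCentralSeries ℤ L L k = ⊥ :=
      LieModule.IsNilpotent.nilpotent ℤ L L
    have h2 : LieModule.lowerCentralSeries ℤ L L 𝒢.cls = ⊥ := Nat.sInf_mem h1
    rw [SetLike.ext'_iff, LieModule.coe_lowerCentralSeries_eq_int ℝ L L, h2]
    rfl
  have h' := LieModule.antitone_lowerCentralSeries ℝ L L hm
  rw [h, le_bot_iff] at h'
  have := 𝒢.le_lcs m
  rw [h'] at this
  simpa using this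

theorem proj_eq_zero {k : ℕ} (hk : 𝒢.cls < k) (x : L) : 𝒢.proj k x = 0 := by
  have h := 𝒢.proj_mem k x
  rwa [𝒢.R_eq_bot hk, Submodule.mem_bot] at h

theorem sum_proj (x : L) : ∑ k ∈ Finset.range (𝒢.cls + 1), 𝒢.proj k x = x := by
  have : ∑ k ∈ Finset.range (𝒢.cls + 1), 𝒢.proj k = LinearMap.id := by
    refine 𝒢.ext_mem fun k x hx => ?_
    simp only [LinearMap.sum_apply, 𝒢.proj_of_mem hx, LinearMap.id_apply]
    rw [Finset.sum_ite_eq' (Finset.range (𝒢.cls + 1)) k (fun _ => x)]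
    split_ifs with hk
    · rfl
    · rw [Finset.mem_range, not_lt] at hk
      rw [𝒢.R_eq_bot (by omega), Submodule.mem_bot] at hx
      exact hx.symm
  simpa using LinearMap.congr_fun this x

/-- The linear map that multiplies each component `R_k` by `c k`. -/
noncomputable def scale (c : ℕ → ℝ) : L →ₗ[ℝ] L :=
  ∑ k ∈ Finset.range (𝒢.cls + 1), c k • 𝒢.proj k

theorem scale_of_mem (c : ℕ → ℝ) {k : ℕ} {x : L} (hx : x ∈ 𝒢.R k) :
    𝒢.scale c x = c k • x := by
  have h := 𝒢.sum_proj x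
  simp only [scale, LinearMap.sum_apply, LinearMap.smul_apply, 𝒢.proj_of_mem hx]
  simp only [smul_ite, smul_zero]
  rw [Finset.sum_ite_eq' (Finset.range (𝒢.cls + 1)) k (fun k => c k • x)]
  split_ifs with hk
  · rfl
  · rw [Finset.mem_range, not_lt] at hk
    rw [𝒢.R_eq_bot (by omega), Submodule.mem_bot] at hx
    simp [hx]

theorem proj_scale (c : ℕ → ℝ) (k : ℕ) (x : L) : 𝒢.proj k (𝒢.scale c x) = c k • 𝒢.proj k x := by
  have : 𝒢.proj k ∘ₗ 𝒢.scale c = c k • 𝒢.proj k := by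
    refine 𝒢.ext_mem fun j x hx => ?_
    simp only [LinearMap.comp_apply, LinearMap.smul_apply, 𝒢.scale_of_mem c hx, map_smul,
      𝒢.proj_of_mem hx]
    split_ifs with h
    · rw [h]
    · simp
  exact LinearMap.congr_fun this x

/-- The derivation `D` with `D a = k a` for `a ∈ R_k`. -/
noncomputable def D : LieDerivation ℝ L L where
  toLinearMap := 𝒢.scale fun k => (k : ℝ)
  leibniz' x y := by
    have key : (LieModule.toEnd ℝ L L : L →ₗ[ℝ] L →ₗ[ℝ] L).compr₂ (𝒢.scale fun k => (k : ℝ)) =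
        (LieModule.toEnd ℝ L L : L →ₗ[ℝ] L →ₗ[ℝ] L).compl₂ (𝒢.scale fun k => (k : ℝ)) +
        (LieModule.toEnd ℝ L L : L →ₗ[ℝ] L →ₗ[ℝ] L) ∘ₗ (𝒢.scale fun k => (k : ℝ)) := by
      refine 𝒢.lie_ext fun i x hx j y hy => ?_
      simp [𝒢.scale_of_mem _ hx, 𝒢.scale_of_mem _ hy, 𝒢.scale_of_mem _ (𝒢.lie_mem i j x hx y hy),
        add_smul, add_comm]
    have h := LinearMap.congr_fun₂ key x y
    simp only [LinearMap.compr₂_apply, LinearMap.add_apply, LinearMap.compl₂_apply,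
      LinearMap.comp_apply, LieHom.coe_toLinearMap, LieModule.toEnd_apply_apply] at h
    rw [h, ← lie_skew y, sub_eq_add_neg, neg_neg]

theorem D_apply (x : L) : 𝒢.D x = 𝒢.scale (fun k => (k : ℝ)) x := rfl

/-- The dilation `a_k ↦ r ^ k a_k` of `L`. -/
noncomputable def dil (r : ℝ) : L →ₗ[ℝ] L := 𝒢.scale fun k => r ^ k

theorem dil_lie (r : ℝ) (x y : L) : 𝒢.dil r ⁅x, y⁆ = ⁅𝒢.dil r x, 𝒢.dil r y⁆ := by
  have key : (LieModule.toEnd ℝ L L : L →ₗ[ℝ] L →ₗ[ℝ] L).compr₂ (𝒢.dil r) =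
      ((LieModule.toEnd ℝ L L : L →ₗ[ℝ] L →ₗ[ℝ] L).compl₂ (𝒢.dil r)) ∘ₗ (𝒢.dil r) := by
    refine 𝒢.lie_ext fun i x hx j y hy => ?_
    simp [dil, 𝒢.scale_of_mem _ hx, 𝒢.scale_of_mem _ hy,
      𝒢.scale_of_mem _ (𝒢.lie_mem i j x hx y hy), pow_add, smul_smul]
  simpa using LinearMap.congr_fun₂ key x y

theorem dil_D (r : ℝ) (x : L) : 𝒢.dil r (𝒢.D x) = 𝒢.D (𝒢.dil r x) := by
  have : 𝒢.dil r ∘ₗ 𝒢.scale (fun k => (k : ℝ)) = 𝒢.scale (fun k => (k : ℝ)) ∘ₗ 𝒢.dil r := by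
    refine 𝒢.ext_mem fun i x hx => ?_
    simp [dil, 𝒢.scale_of_mem _ hx, smul_smul, mul_comm]
  exact LinearMap.congr_fun this x

theorem dil_one (x : L) : 𝒢.dil 1 x = x := by
  have : 𝒢.dil 1 = LinearMap.id := 𝒢.ext_mem fun i x hx => by simp [dil, 𝒢.scale_of_mem _ hx]
  simp [this]

theorem dil_mul (r s : ℝ) (x : L) : 𝒢.dil (r * s) x = 𝒢.dil r (𝒢.dil s x) := by
  have : 𝒢.dil (r * s) = 𝒢.dil r ∘ₗ 𝒢.dil s :=
    𝒢.ext_mem fun i x hx => by simp [dil, 𝒢.scale_of_mem _ hx, mul_pow, smul_smul, mul_comm]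
  simp [this]

/-! The solvable extension of `L` by the derivation `D`. -/

attribute [local instance 100] LieRing.ofAssociativeRing

/-- The homomorphism `s ↦ s D` from the abelian Lie algebra `ℝ` to the derivations of `L`. -/
noncomputable def lineD : ℝ →ₗ⁅ℝ⁆ LieDerivation ℝ L L where
  toLinearMap := LinearMap.toSpanSingleton ℝ _ 𝒢.D
  map_lie' {x y} := by
    have : ⁅x, y⁆ = 0 := by rw [LieRing.of_associative_ring_bracket, mul_comm, sub_self]
    simp [this]

theorem lineD_apply (s : ℝ) (x : L) : 𝒢.lineD s x = s • 𝒢.D x := rfl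

/-- The Lie algebra `L ⊕ ℝ D`, with `[D, a] = D a` for `a ∈ L`. -/
abbrev Ext : Type _ := L ⋊⁅𝒢.lineD⁆ ℝ

noncomputable instance : Module ℚ 𝒢.Ext := Module.compHom _ (algebraMap ℚ ℝ)

/-- The operator `ad a` on `L ⊕ ℝ D`, for `a ∈ L`. -/
noncomputable def adE : L →ₗ[ℝ] Module.End ℝ 𝒢.Ext :=
  (LieModule.toEnd ℝ 𝒢.Ext 𝒢.Ext : 𝒢.Ext →ₗ[ℝ] Module.End ℝ 𝒢.Ext) ∘ₗ
    (LieAlgebra.SemiDirectSum.inl 𝒢.lineD : L →ₗ[ℝ] 𝒢.Ext)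

theorem adE_apply (a : L) (x : 𝒢.Ext) :
    𝒢.adE a x = ⟨⁅a, x.left⁆ - x.right • 𝒢.D a, 0⟩ := by
  change ⁅(⟨a, 0⟩ : 𝒢.Ext), x⁆ = _
  rw [LieAlgebra.SemiDirectSum.lie_eq_mk]
  simp [lineD_apply]


theorem smul_mk (t : ℝ) (x : 𝒢.Ext) : t • x = ⟨t • x.left, t • x.right⟩ := rfl

theorem rat_smul_eq (q : ℚ) (x : 𝒢.Ext) : q • x = (q : ℝ) • x := rfl

theorem eq_zero_of_mem_tail {k : ℕ} (hk : 𝒢.cls < k) {x : L} (hx : x ∈ 𝒢.tail k) : x = 0 := by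
  rw [mem_tail] at hx
  rw [← 𝒢.sum_proj x]
  exact Finset.sum_eq_zero fun j hj => hx j (by simp at hj; omega)

theorem scale_tail (c : ℕ → ℝ) {k : ℕ} {x : L} (hx : x ∈ 𝒢.tail k) :
    𝒢.scale c x ∈ 𝒢.tail k := by
  rw [mem_tail] at *
  intro j hj
  rw [proj_scale, hx j hj, smul_zero]

theorem lie_tail {i j : ℕ} {x y : L} (hx : x ∈ 𝒢.tail i) (hy : y ∈ 𝒢.tail j) :
    ⁅x, y⁆ ∈ 𝒢.tail (i + j) := by
  rw [mem_tail] at *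
  intro m hm
  rw [← 𝒢.sum_proj x, ← 𝒢.sum_proj y, sum_lie, map_sum]
  refine Finset.sum_eq_zero fun p _ => ?_
  rw [lie_sum, map_sum]
  refine Finset.sum_eq_zero fun q _ => ?_
  by_cases hp : p < i
  · simp [hx p hp]
  by_cases hq : q < j
  · simp [hy q hq]
  rw [𝒢.proj_of_mem (𝒢.lie_mem p q _ (𝒢.proj_mem p x) _ (𝒢.proj_mem q y)), if_neg (by omega)]

/-- The elements of `L ⊕ ℝ D` that lie in `L` and have no component of degree below `k`. -/
noncomputable def tailE (k : ℕ) : Submodule ℝ 𝒢.Ext where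
  carrier := {x | x.left ∈ 𝒢.tail k ∧ x.right = 0}
  add_mem' {x y} hx hy := by
    refine ⟨(𝒢.tail k).add_mem hx.1 hy.1, ?_⟩
    simp [hx.2, hy.2]
  zero_mem' := ⟨(𝒢.tail k).zero_mem, rfl⟩
  smul_mem' t x hx := by
    refine ⟨(𝒢.tail k).smul_mem t hx.1, ?_⟩
    simp [hx.2]

theorem tailE_anti {j k : ℕ} (h : j ≤ k) {x : 𝒢.Ext} (hx : x ∈ 𝒢.tailE k) : x ∈ 𝒢.tailE j :=
  ⟨𝒢.tail_anti h hx.1, hx.2⟩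

theorem eq_zero_of_mem_tailE {k : ℕ} (hk : 𝒢.cls < k) {x : 𝒢.Ext} (hx : x ∈ 𝒢.tailE k) :
    x = 0 := by
  obtain ⟨l, r⟩ := x
  have h1 : l = 0 := 𝒢.eq_zero_of_mem_tail hk hx.1
  have h2 : r = 0 := hx.2
  subst h1 h2
  rfl

theorem adE_mem {k : ℕ} {a : L} (ha : a ∈ 𝒢.tail k) (x : 𝒢.Ext) : 𝒢.adE a x ∈ 𝒢.tailE k := by
  rw [adE_apply]
  refine ⟨(𝒢.tail k).sub_mem ?_ ((𝒢.tail k).smul_mem _ (𝒢.scale_tail _ ha)), rfl⟩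
  exact 𝒢.tail_anti (by omega) (𝒢.lie_tail ha (𝒢.mem_tail_one x.left))

theorem adE_tail {i k : ℕ} {a : L} (ha : a ∈ 𝒢.tail i) {x : 𝒢.Ext} (hx : x ∈ 𝒢.tailE k) :
    𝒢.adE a x ∈ 𝒢.tailE (i + k) := by
  rw [adE_apply, hx.2, zero_smul, sub_zero]
  exact ⟨𝒢.lie_tail ha hx.1, rfl⟩

theorem adE_pow_mem (a : L) (m : ℕ) (x : 𝒢.Ext) : (𝒢.adE a ^ (m + 1)) x ∈ 𝒢.tailE (m + 1) := by
  induction m with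
  | zero => simpa using 𝒢.adE_mem (𝒢.mem_tail_one a) x
  | succ m ih =>
    rw [pow_succ']
    have := 𝒢.adE_tail (𝒢.mem_tail_one a) ih
    rwa [add_comm 1] at this

theorem adE_pow_eq_zero (a : L) : 𝒢.adE a ^ (𝒢.cls + 1) = 0 := by
  ext1 x
  exact 𝒢.eq_zero_of_mem_tailE (Nat.lt_succ_self _) (𝒢.adE_pow_mem a 𝒢.cls x)

theorem adE_nilpotent (a : L) : IsNilpotent (𝒢.adE a) := ⟨_, 𝒢.adE_pow_eq_zero a⟩

/-- The operator `exp (ad a)` on `L ⊕ ℝ D`, for `a ∈ L`. -/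
noncomputable def expAd (a : L) : Module.End ℝ 𝒢.Ext := IsNilpotent.exp (𝒢.adE a)

theorem expAd_zero : 𝒢.expAd 0 = 1 := by simp [expAd]

theorem expAd_mul_neg (a : L) : 𝒢.expAd a * 𝒢.expAd (-a) = 1 := by
  rw [expAd, expAd, map_neg, IsNilpotent.exp_mul_exp_neg_self (𝒢.adE_nilpotent a)]

theorem expAd_neg_mul (a : L) : 𝒢.expAd (-a) * 𝒢.expAd a = 1 := by
  rw [expAd, expAd, map_neg, IsNilpotent.exp_neg_mul_exp_self (𝒢.adE_nilpotent a)]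

theorem expAd_eq_sum (a : L) : 𝒢.expAd a =
    ∑ i ∈ Finset.range (𝒢.cls + 1), (i.factorial : ℚ)⁻¹ • (𝒢.adE a ^ i) :=
  IsNilpotent.exp_eq_sum (𝒢.adE_pow_eq_zero a)

theorem expAd_lie (a : L) (x y : 𝒢.Ext) : 𝒢.expAd a ⁅x, y⁆ = ⁅𝒢.expAd a x, 𝒢.expAd a y⁆ := by
  let _i := LieRing.toNonUnitalNonAssocRing 𝒢.Ext
  have : SMulCommClass ℝ 𝒢.Ext 𝒢.Ext := LieAlgebra.smulCommClass ℝ 𝒢.Ext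
  have : IsScalarTower ℝ 𝒢.Ext 𝒢.Ext := LieAlgebra.isScalarTower ℝ 𝒢.Ext
  refine Module.End.exp_mul_of_derivation ℝ 𝒢.Ext (𝒢.adE a) (fun x y => ?_) (𝒢.adE_nilpotent a) x y
  change ⁅(⟨a, 0⟩ : 𝒢.Ext), ⁅x, y⁆⁆ = ⁅x, ⁅(⟨a, 0⟩ : 𝒢.Ext), y⁆⁆ + ⁅⁅(⟨a, 0⟩ : 𝒢.Ext), x⁆, y⁆
  rw [leibniz_lie, add_comm]

/-- The element `D` of `L ⊕ ℝ D`. -/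
def elD : 𝒢.Ext := ⟨0, 1⟩

theorem pow_add_sub_mem {k : ℕ} (a : L) {b : L} (hb : b ∈ 𝒢.tail k) (m : ℕ)
    (x : 𝒢.Ext) : (𝒢.adE (a + b) ^ (m + 1)) x - (𝒢.adE a ^ (m + 1)) x ∈ 𝒢.tailE (k + m) := by
  induction m with
  | zero => simpa using 𝒢.adE_mem hb x
  | succ m ih =>
    have h : (𝒢.adE (a + b) ^ (m + 1 + 1)) x - (𝒢.adE a ^ (m + 1 + 1)) x =
        𝒢.adE (a + b) ((𝒢.adE (a + b) ^ (m + 1)) x - (𝒢.adE a ^ (m + 1)) x) +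
          𝒢.adE b ((𝒢.adE a ^ (m + 1)) x) := by
      rw [pow_succ' _ (m + 1), pow_succ' _ (m + 1), Module.End.mul_apply, Module.End.mul_apply,
        map_sub, map_add, LinearMap.add_apply, LinearMap.add_apply]
      abel
    rw [h]
    refine (𝒢.tailE _).add_mem ?_ ?_
    · have := 𝒢.adE_tail (𝒢.mem_tail_one (a + b)) ih
      exact 𝒢.tailE_anti (by omega) this
    · exact 𝒢.adE_tail hb (𝒢.adE_pow_mem a m x)

theorem expAd_add_sub {k : ℕ} (a : L) {b : L} (hb : b ∈ 𝒢.tail k) (x : 𝒢.Ext) :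
    𝒢.expAd (a + b) x - 𝒢.expAd a x - 𝒢.adE b x ∈ 𝒢.tailE (k + 1) := by
  rw [expAd, expAd, IsNilpotent.exp_eq_sum (k := 𝒢.cls + 2)
      (by rw [pow_succ, adE_pow_eq_zero, zero_mul]),
    IsNilpotent.exp_eq_sum (k := 𝒢.cls + 2) (by rw [pow_succ, adE_pow_eq_zero, zero_mul])]
  rw [Finset.sum_range_succ' _ (𝒢.cls + 1), Finset.sum_range_succ' _ (𝒢.cls + 1),
    Finset.sum_range_succ' _ 𝒢.cls, Finset.sum_range_succ' _ 𝒢.cls]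
  have h : ∀ (A B : Module.End ℝ 𝒢.Ext),
    (∑ i ∈ Finset.range 𝒢.cls, (((i + 1 + 1).factorial : ℚ))⁻¹ • A ^ (i + 1 + 1)) x -
    (∑ i ∈ Finset.range 𝒢.cls, (((i + 1 + 1).factorial : ℚ))⁻¹ • B ^ (i + 1 + 1)) x =
    ∑ i ∈ Finset.range 𝒢.cls, (((i + 1 + 1).factorial : ℚ))⁻¹ •
      ((A ^ (i + 1 + 1)) x - (B ^ (i + 1 + 1)) x) := by
    intro A B
    rw [LinearMap.sum_apply, LinearMap.sum_apply, ← Finset.sum_sub_distrib]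
    exact Finset.sum_congr rfl fun i _ => by
      rw [smul_sub]; rfl
  have h2 : ∑ i ∈ Finset.range 𝒢.cls, (((i + 1 + 1).factorial : ℚ))⁻¹ •
      ((𝒢.adE (a + b) ^ (i + 1 + 1)) x - (𝒢.adE a ^ (i + 1 + 1)) x) ∈ 𝒢.tailE (k + 1) := by
    refine Submodule.sum_mem _ fun i _ => ?_
    rw [rat_smul_eq]
    exact (𝒢.tailE _).smul_mem _
      (𝒢.tailE_anti (by omega) (𝒢.pow_add_sub_mem a hb (i + 1) x))
  rw [← h] at h2
  convert! h2 using 1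
  simp only [LinearMap.add_apply, map_add, zero_add, pow_one, pow_zero, Nat.factorial_one,
    Nat.factorial_zero, Nat.cast_one, inv_one, one_smul]
  abel

theorem expAd_sub_self_mem_of (a : L) (S : Submodule ℝ 𝒢.Ext) (x : 𝒢.Ext)
    (h : ∀ i, (𝒢.adE a ^ (i + 1)) x ∈ S) : 𝒢.expAd a x - x ∈ S := by
  rw [expAd_eq_sum, Finset.sum_range_succ', LinearMap.add_apply]
  simp only [Nat.factorial_zero, Nat.cast_one, inv_one, one_smul, pow_zero, Module.End.one_apply,
    add_sub_cancel_right, LinearMap.sum_apply]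
  exact S.sum_mem fun i _ => S.smul_mem (((i + 1).factorial : ℚ)⁻¹ : ℚ) (h i)

theorem expAd_sub_self_mem (a : L) {k : ℕ} {x : 𝒢.Ext} (hx : x ∈ 𝒢.tailE k) :
    𝒢.expAd a x - x ∈ 𝒢.tailE (k + 1) := by
  refine 𝒢.expAd_sub_self_mem_of a _ x fun i => ?_
  induction i with
  | zero => simpa [add_comm] using 𝒢.adE_tail (𝒢.mem_tail_one a) hx
  | succ i ih =>
    rw [pow_succ']
    exact 𝒢.tailE_anti (by omega) (𝒢.adE_tail (𝒢.mem_tail_one a) ih)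

theorem expAd_right (a : L) (x : 𝒢.Ext) : (𝒢.expAd a x).right = x.right := by
  have h := 𝒢.expAd_sub_self_mem_of a (𝒢.tailE 1) x
    fun i => 𝒢.tailE_anti (by omega) (𝒢.adE_pow_mem a i x)
  have h2 : (𝒢.expAd a x).right - x.right = 0 := h.2
  linarith

theorem expAd_elD_injective {a b : L} (h : 𝒢.expAd a 𝒢.elD = 𝒢.expAd b 𝒢.elD) : a = b := by
  have key : ∀ k, b - a ∈ 𝒢.tail (k + 1) := by
    intro k
    induction k with
    | zero => exact 𝒢.mem_tail_one _
    | succ k ih =>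
      have h1 := 𝒢.expAd_add_sub a ih 𝒢.elD
      rw [add_sub_cancel, ← h, sub_self, zero_sub] at h1
      have h2 := ((𝒢.tailE _).neg_mem h1).1
      rw [neg_neg, adE_apply] at h2
      simp only [elD, lie_zero, one_smul, zero_sub] at h2
      have h3 := (𝒢.tail _).neg_mem h2
      rw [neg_neg, mem_tail] at h3
      rw [mem_tail]
      intro j hj
      have h4 := h3 j hj
      rw [D_apply, proj_scale, smul_eq_zero] at h4
      rcases h4 with h4 | h4
      · have : j = 0 := by exact_mod_cast h4
        rw [this]
        exact 𝒢.proj_zero _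
      · exact h4
  exact (sub_eq_zero.1 (𝒢.eq_zero_of_mem_tail (Nat.lt_succ_self _) (key 𝒢.cls))).symm

theorem exists_expAd_elD (y : L) : ∃ a, 𝒢.expAd a 𝒢.elD = ⟨y, 1⟩ := by
  have key : ∀ k, ∃ a, 𝒢.expAd a 𝒢.elD - ⟨y, 1⟩ ∈ 𝒢.tailE (k + 1) := by
    intro k
    induction k with
    | zero =>
      refine ⟨0, 𝒢.mem_tail_one _, ?_⟩
      rw [expAd_zero]
      simp [elD, sub_self]
    | succ k ih =>
      obtain ⟨a, ha⟩ := ih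
      set z := (𝒢.expAd a 𝒢.elD - ⟨y, 1⟩ : 𝒢.Ext) with hz
      set c : L := ((k + 1 : ℕ) : ℝ)⁻¹ • 𝒢.proj (k + 1) z.left with hc
      have hcR : c ∈ 𝒢.R (k + 1) := (𝒢.R _).smul_mem _ (𝒢.proj_mem _ _)
      have hct : c ∈ 𝒢.tail (k + 1) := by
        rw [mem_tail]
        intro j hj
        rw [𝒢.proj_of_mem hcR, if_neg (by omega)]
      refine ⟨a + c, ?_⟩
      have h1 := 𝒢.expAd_add_sub a hct 𝒢.elD
      have h2 : 𝒢.expAd (a + c) 𝒢.elD - ⟨y, 1⟩ =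
          (𝒢.expAd (a + c) 𝒢.elD - 𝒢.expAd a 𝒢.elD - 𝒢.adE c 𝒢.elD) + (𝒢.adE c 𝒢.elD + z) := by
        rw [hz]; abel
      rw [h2]
      refine (𝒢.tailE _).add_mem h1 ?_
      rw [adE_apply]
      refine ⟨?_, ?_⟩
      · simp only [LieAlgebra.SemiDirectSum.add_eq_mk, elD, lie_zero, one_smul, zero_sub]
        rw [mem_tail]
        intro j hj
        rw [D_apply, 𝒢.scale_of_mem _ hcR, hc, smul_smul, mul_inv_cancel₀ (by positivity),
          one_smul, map_add, map_neg, 𝒢.proj_of_mem (𝒢.proj_mem _ _)]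
        split_ifs with hjk
        · rw [hjk, neg_add_cancel]
        · rw [neg_zero, zero_add]
          exact (𝒢.mem_tail.1 ha.1) j (by omega)
      · simp only [LieAlgebra.SemiDirectSum.add_eq_mk, ha.2, add_zero]
  obtain ⟨a, ha⟩ := key 𝒢.cls
  exact ⟨a, sub_eq_zero.1 (𝒢.eq_zero_of_mem_tailE (Nat.lt_succ_self _) ha)⟩

theorem mem_R_of_D {k : ℕ} {x : L} (h : 𝒢.D x = (k : ℝ) • x) : 𝒢.proj k x = x := by
  conv_rhs => rw [← 𝒢.sum_proj x]
  have h0 : ∀ j, j ≠ k → 𝒢.proj j x = 0 := by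
    intro j hj
    have h1 := congrArg (𝒢.proj j) h
    rw [D_apply, proj_scale, map_smul, ← sub_eq_zero, ← sub_smul, smul_eq_zero] at h1
    rcases h1 with h1 | h1
    · exact absurd (by exact_mod_cast sub_eq_zero.1 h1) hj
    · exact h1
  by_cases hk : k ∈ Finset.range (𝒢.cls + 1)
  · exact (Finset.sum_eq_single_of_mem k hk fun j _ hj => h0 j hj).symm
  · rw [Finset.sum_eq_zero fun j hj => h0 j fun h => hk (h ▸ hj)]
    exact 𝒢.proj_eq_zero (by simpa using hk) x

/-- An automorphism of `L ⊕ ℝ D` that fixes `D` and raises degrees up to the identity is trivial. -/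
theorem eq_one_of_fix (ψ : Module.End ℝ 𝒢.Ext) (hlie : ∀ x y, ψ ⁅x, y⁆ = ⁅ψ x, ψ y⁆)
    (hD : ψ 𝒢.elD = 𝒢.elD) (hψ : ∀ k, ∀ x ∈ 𝒢.tailE k, ψ x - x ∈ 𝒢.tailE (k + 1)) : ψ = 1 := by
  have hbr : ∀ x : 𝒢.Ext, ⁅𝒢.elD, x⁆ = ⟨𝒢.D x.left, 0⟩ := by
    intro x
    rw [LieAlgebra.SemiDirectSum.lie_eq_mk]
    have h0 : ⁅(1 : ℝ), x.right⁆ = 0 := by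
      rw [LieRing.of_associative_ring_bracket, mul_comm, sub_self]
    simp [lineD_apply, elD, h0]
  have hL : ψ ∘ₗ (LieAlgebra.SemiDirectSum.inl 𝒢.lineD : L →ₗ[ℝ] 𝒢.Ext) =
      (LieAlgebra.SemiDirectSum.inl 𝒢.lineD : L →ₗ[ℝ] 𝒢.Ext) := by
    refine 𝒢.ext_mem fun k l hl => ?_
    change ψ ⟨l, 0⟩ = ⟨l, 0⟩
    have hmem : (⟨l, 0⟩ : 𝒢.Ext) ∈ 𝒢.tailE k := by
      refine ⟨?_, rfl⟩
      rw [mem_tail]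
      intro j hj
      rw [𝒢.proj_of_mem hl, if_neg (by omega)]
    have h1 := hψ k _ hmem
    have h2 := hlie 𝒢.elD ⟨l, 0⟩
    rw [hD, hbr, hbr, D_apply, 𝒢.scale_of_mem _ hl] at h2
    have h3 : (⟨(k : ℝ) • l, 0⟩ : 𝒢.Ext) = (k : ℝ) • ⟨l, 0⟩ := by
      rw [smul_mk]; simp
    rw [h3, map_smul] at h2
    have h4 : 𝒢.D (ψ ⟨l, 0⟩).left = (k : ℝ) • (ψ ⟨l, 0⟩).left :=
      (congrArg LieAlgebra.SemiDirectSum.left h2).symm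
    have h5 := 𝒢.mem_R_of_D h4
    have h6 : 𝒢.proj k ((ψ ⟨l, 0⟩).left - l) = 0 := 𝒢.mem_tail.1 h1.1 k (by omega)
    rw [map_sub, h5, 𝒢.proj_of_mem hl, if_pos rfl, sub_eq_zero] at h6
    have h7 : (ψ ⟨l, 0⟩).right - 0 = 0 := h1.2
    rw [sub_zero] at h7
    exact LieAlgebra.SemiDirectSum.ext h6 h7
  ext1 x
  have hx : x = (⟨x.left, 0⟩ : 𝒢.Ext) + x.right • 𝒢.elD := by
    rw [smul_mk, LieAlgebra.SemiDirectSum.add_eq_mk]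
    simp [elD]
  have h8 : ψ ⟨x.left, 0⟩ = ⟨x.left, 0⟩ := LinearMap.congr_fun hL x.left
  rw [hx, map_add, map_smul, hD, h8]
  rfl

theorem exists_expAd_mul (a b : L) : ∃ c, 𝒢.expAd c = 𝒢.expAd a * 𝒢.expAd b := by
  obtain ⟨c, hc⟩ := 𝒢.exists_expAd_elD (𝒢.expAd a (𝒢.expAd b 𝒢.elD)).left
  have hc' : 𝒢.expAd c 𝒢.elD = 𝒢.expAd a (𝒢.expAd b 𝒢.elD) := by
    rw [hc]
    refine LieAlgebra.SemiDirectSum.ext rfl ?_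
    rw [expAd_right, expAd_right]
    rfl
  have hone : 𝒢.expAd (-c) * (𝒢.expAd a * 𝒢.expAd b) = 1 := by
    refine 𝒢.eq_one_of_fix _ (fun x y => ?_) ?_ (fun k x hx => ?_)
    · simp only [Module.End.mul_apply, expAd_lie]
    · simp only [Module.End.mul_apply]
      rw [← hc', ← Module.End.mul_apply, expAd_neg_mul, Module.End.one_apply]
    · simp only [Module.End.mul_apply]
      have step : ∀ (a : L) (z : 𝒢.Ext), z - x ∈ 𝒢.tailE (k + 1) →
          𝒢.expAd a z - x ∈ 𝒢.tailE (k + 1) := by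
        intro a z hz
        have hzk : z ∈ 𝒢.tailE k := by
          have := (𝒢.tailE k).add_mem (𝒢.tailE_anti (by omega) hz) hx
          rwa [sub_add_cancel] at this
        have := (𝒢.tailE _).add_mem (𝒢.expAd_sub_self_mem a hzk) hz
        rwa [sub_add_sub_cancel] at this
      exact step _ _ (step _ _ (𝒢.expAd_sub_self_mem b hx))
  refine ⟨c, ?_⟩
  calc 𝒢.expAd c = 𝒢.expAd c * (𝒢.expAd (-c) * (𝒢.expAd a * 𝒢.expAd b)) := by rw [hone, mul_one]
    _ = 𝒢.expAd a * 𝒢.expAd b := by rw [← mul_assoc, expAd_mul_neg, one_mul]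

theorem expAd_injective {a b : L} (h : 𝒢.expAd a = 𝒢.expAd b) : a = b :=
  𝒢.expAd_elD_injective (by rw [h])

theorem expAd_dil (r : ℝ) (a : L) (x : 𝒢.Ext) :
    𝒢.expAd (𝒢.dil r a) ⟨𝒢.dil r x.left, x.right⟩ =
      ⟨𝒢.dil r (𝒢.expAd a x).left, (𝒢.expAd a x).right⟩ := by
  let Δ : 𝒢.Ext →ₗ[ℝ] 𝒢.Ext :=
    { toFun := fun x => ⟨𝒢.dil r x.left, x.right⟩
      map_add' := fun x y => by simp
      map_smul' := fun t x => by simp }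
  have h := Module.End.commute_exp_left_of_commute (𝒢.adE_nilpotent a)
    (𝒢.adE_nilpotent (𝒢.dil r a)) (g := Δ) (by
      ext1 x
      have hΔ : ∀ x : 𝒢.Ext, Δ x = ⟨𝒢.dil r x.left, x.right⟩ := fun _ => rfl
      simp only [LinearMap.comp_apply, adE_apply, hΔ]
      simp [dil_lie, dil_D])
  exact LinearMap.congr_fun h x

/-- The connected and simply connected Lie group `N` with Lie algebra `L`, in canonical
(exponential) coordinates: the element with coordinate `a ∈ L` is `exp a`. -/
@[ext]
structure N (𝒢 : LieGrading L) where
  /-- The coordinate `a ∈ L` of `exp a`. -/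
  log : L

/-- The product of `N` in canonical coordinates is the Baker-Campbell-Hausdorff product of `L`:
`exp a * exp b = exp c` for the unique `c ∈ L` with `exp (ad c) = exp (ad a) exp (ad b)` on
`L ⊕ ℝ D`, where `ad` is a faithful representation of `L`. -/
noncomputable instance : Mul 𝒢.N := ⟨fun x y => ⟨(𝒢.exists_expAd_mul x.log y.log).choose⟩⟩

noncomputable instance : One 𝒢.N := ⟨⟨0⟩⟩

noncomputable instance : Inv 𝒢.N := ⟨fun x => ⟨-x.log⟩⟩

theorem expAd_mul (x y : 𝒢.N) : 𝒢.expAd (x * y).log = 𝒢.expAd x.log * 𝒢.expAd y.log :=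
  (𝒢.exists_expAd_mul x.log y.log).choose_spec

noncomputable instance : Group 𝒢.N where
  mul_assoc x y z := N.ext (𝒢.expAd_injective (by simp only [expAd_mul, mul_assoc]))
  one_mul x := N.ext (𝒢.expAd_injective (by
    rw [expAd_mul]; change 𝒢.expAd 0 * _ = _; rw [expAd_zero, one_mul]))
  mul_one x := N.ext (𝒢.expAd_injective (by
    rw [expAd_mul]; change _ * 𝒢.expAd 0 = _; rw [expAd_zero, mul_one]))
  inv_mul_cancel x := N.ext (𝒢.expAd_injective (by
    rw [expAd_mul]; change 𝒢.expAd (-x.log) * _ = 𝒢.expAd 0; rw [expAd_neg_mul, expAd_zero]))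

/-- `N` carries the usual topology of the finite-dimensional real vector space `L`. -/
instance : TopologicalSpace 𝒢.N := (moduleTopology ℝ L).induced N.log

theorem dil_mul_log (r : ℝ) (x y : 𝒢.N) :
    𝒢.dil r (x * y).log = ((⟨𝒢.dil r x.log⟩ : 𝒢.N) * ⟨𝒢.dil r y.log⟩).log := by
  refine 𝒢.expAd_elD_injective ?_
  have hD : 𝒢.elD = ⟨𝒢.dil r 𝒢.elD.left, 𝒢.elD.right⟩ := by simp [elD]
  rw [expAd_mul, Module.End.mul_apply]
  conv_lhs => rw [hD, expAd_dil, expAd_mul, Module.End.mul_apply]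
  conv_rhs => rw [hD, expAd_dil, expAd_dil]

/-- The action of the multiplicative group of positive reals on `N` by automorphisms:
`a_k ↦ r ^ k a_k` for `a_k ∈ R_k`. -/
noncomputable def dilation : PosReal →* MulAut 𝒢.N where
  toFun r :=
    { toFun := fun x => ⟨𝒢.dil r x.log⟩
      invFun := fun x => ⟨𝒢.dil (r : ℝ)⁻¹ x.log⟩
      left_inv := fun x => N.ext (by
        simp only [← dil_mul, inv_mul_cancel₀ r.2.ne', dil_one])
      right_inv := fun x => N.ext (by
        simp only [← dil_mul, mul_inv_cancel₀ r.2.ne', dil_one])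
      map_mul' := fun x y => N.ext (𝒢.dil_mul_log r x y) }
  map_one' := by ext x; exact 𝒢.dil_one x.log
  map_mul' r s := by ext x; exact 𝒢.dil_mul r s x.log

end LieGrading

/-! Unitary representations and 1-cocycles. -/

/-- A unitary representation of the topological group `G` in the complex Hilbert space `H`. -/
structure UnitaryRep (G : Type*) [Group G] [TopologicalSpace G]
    (H : Type*) [NormedAddCommGroup H] [InnerProductSpace ℂ H] where
  /-- The operators of the representation. -/
  op : G →* (H ≃ₗᵢ[ℂ] H)
  continuous_op : ∀ v : H, Continuous fun g => op g v

namespace UnitaryRep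

section Basic

variable {G : Type*} [Group G] [TopologicalSpace G]
  {H : Type*} [NormedAddCommGroup H] [InnerProductSpace ℂ H] (T : UnitaryRep G H)

/-- `T` is irreducible: `H ≠ 0`, and `0` and `H` are the only closed invariant subspaces. -/
def IsIrreducible : Prop :=
  Nontrivial H ∧ ∀ W : Submodule ℂ H, IsClosed (W : Set H) →
    (∀ g, ∀ v ∈ W, T.op g v ∈ W) → W = ⊥ ∨ W = ⊤

/-- `H` contains no nonzero vector invariant under all operators `T g`. -/
def NoInvariantVectors : Prop :=
  ∀ v : H, (∀ g, T.op g v = v) → v = 0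

/-- A 1-cocycle of `T`: a continuous map `β` with `β (g₁ g₂) = T g₁ (β g₂) + β g₁`. -/
def IsCocycle (β : G → H) : Prop :=
  Continuous β ∧ ∀ g₁ g₂, β (g₁ * g₂) = T.op g₁ (β g₂) + β g₁

/-- The trivial 1-cocycles `g ↦ T g h - h`. -/
def IsTrivialCocycle (β : G → H) : Prop :=
  ∃ h : H, ∀ g, β g = T.op g h - h

/-- `T` is special: it has a nontrivial 1-cocycle. -/
def IsSpecial : Prop :=
  ∃ β : G → H, T.IsCocycle β ∧ ¬ T.IsTrivialCocycle β

theorem continuous_op_uncurry : Continuous fun p : G × H => T.op p.1 p.2 :=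
  continuous_prod_of_continuous_lipschitzWith' _ 1
    (fun g => (T.op g).isometry.lipschitz) fun v => T.continuous_op v

end Basic

/-! Summability: `m` is a measure on the positive reals, and an action `δ` of the positive reals on
`N` by automorphisms gives the representations `T_r = T ∘ δ r` conjugate to `T`. -/

section Summable

variable {N : Type*} [Group N] [TopologicalSpace N]
  {H : Type*} [NormedAddCommGroup H] [InnerProductSpace ℂ H]

/-- `m` is infinite, and finite on every `[ε, ∞)` with `ε > 0`. -/
def IsAdmissible (m : Measure PosReal) : Prop :=
  m Set.univ = ⊤ ∧ ∀ ε : PosReal, m (Set.Ici ε) < ⊤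

/-- The measure `exp (- u r / 2) d*r`. -/
noncomputable def weightMeasure (u : ℝ → ℝ) : Measure PosReal :=
  PosReal.haar.withDensity fun r => ENNReal.ofReal (Real.exp (-(u r) / 2))

/-- The nonzero vector `h` is almost invariant: `∫ ‖T_r g h - h‖ dm(r) < ∞` for every `g`. -/
def IsAlmostInvariant (T : UnitaryRep N H) (δ : PosReal →* MulAut N) (m : Measure PosReal)
    (h : H) : Prop :=
  h ≠ 0 ∧ ∀ g, ∫⁻ r, ‖T.op (δ r g) h - h‖ₑ ∂m < ⊤

/-- `T` is summable with respect to `m`: the conjugate representations `T_r` have no nonzero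
invariant vectors, and there is an almost invariant vector. -/
def IsSummable (T : UnitaryRep N H) (δ : PosReal →* MulAut N) (m : Measure PosReal) : Prop :=
  IsAdmissible m ∧ (∀ r, ∀ v : H, (∀ g, T.op (δ r g) v = v) → v = 0) ∧
    ∃ h, T.IsAlmostInvariant δ m h

end Summable

/-! Groups with an action of the positive reals, and the representation `T̃`. -/

section Tilde

variable {N : Type*} [Group N] [TopologicalSpace N]
  {H : Type*} [NormedAddCommGroup H] [InnerProductSpace ℂ H]

/-- The semidirect product `ℝ*₊ ⋉ N`, in which `r g r⁻¹ = δ r g`, has the product topology. -/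
instance (δ : PosReal →* MulAut N) : TopologicalSpace (N ⋊[δ] PosReal) :=
  .induced (fun g => (g.left, g.right)) inferInstance

theorem aestronglyMeasurable_op (T : UnitaryRep N H) {δ : PosReal →* MulAut N}
    (hδ : Continuous fun p : PosReal × N => δ p.1 p.2) (n : N) {f : PosReal → H}
    (hf : AEStronglyMeasurable f PosReal.haar) :
    AEStronglyMeasurable (fun r => T.op (δ r n) (f r)) PosReal.haar := by
  have h : Continuous fun p : PosReal × H => T.op (δ p.1 n) p.2 :=
    T.continuous_op_uncurry.comp
      ((hδ.comp (continuous_fst.prodMk continuous_const)).prodMk continuous_snd)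
  exact h.comp_aestronglyMeasurable
    ((continuous_id.aestronglyMeasurable (μ := PosReal.haar)).prodMk hf)

theorem memLp_tilde (T : UnitaryRep N H) {δ : PosReal →* MulAut N}
    (hδ : Continuous fun p : PosReal × N => δ p.1 p.2) (g : N ⋊[δ] PosReal)
    {f : PosReal → H} (hf : MemLp f 2 PosReal.haar) :
    MemLp (fun r => T.op (δ r g.left) (f (r * g.right))) 2 PosReal.haar := by
  have h := hf.comp_measurePreserving (PosReal.measurePreserving_mul_right g.right)
  refine h.of_le (T.aestronglyMeasurable_op hδ g.left h.1) (.of_forall fun r => ?_)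
  simp

/-- The operator `T̃ g`, for `g = n r₀` with `n ∈ N` and `r₀ ∈ ℝ*₊`, on
`∫ H d*r = L²(ℝ*₊, d*r; H)`: `(T̃ g f) r = T_r n (f (r r₀))` with `T_r n = T (δ r n)`. -/
noncomputable def tildeFun (T : UnitaryRep N H) {δ : PosReal →* MulAut N}
    (hδ : Continuous fun p : PosReal × N => δ p.1 p.2) (g : N ⋊[δ] PosReal)
    (f : Lp H 2 PosReal.haar) : Lp H 2 PosReal.haar :=
  (T.memLp_tilde hδ g (Lp.memLp f)).toLp fun r => T.op (δ r g.left) (f (r * g.right))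

variable (T : UnitaryRep N H) {δ : PosReal →* MulAut N}
  (hδ : Continuous fun p : PosReal × N => δ p.1 p.2)

theorem coeFn_tildeFun (g : N ⋊[δ] PosReal) (f : Lp H 2 PosReal.haar) :
    T.tildeFun hδ g f =ᵐ[PosReal.haar] fun r => T.op (δ r g.left) (f (r * g.right)) :=
  MemLp.coeFn_toLp _

theorem ae_mul_right (s : PosReal) {p : PosReal → Prop} (h : ∀ᵐ r ∂PosReal.haar, p r) :
    ∀ᵐ r ∂PosReal.haar, p (r * s) :=
  (PosReal.measurePreserving_mul_right s).quasiMeasurePreserving.ae h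

theorem tildeFun_one (f : Lp H 2 PosReal.haar) : T.tildeFun hδ 1 f = f := by
  refine Lp.ext ((T.coeFn_tildeFun hδ 1 f).trans (.of_forall fun r => ?_))
  simp

theorem tildeFun_mul (g h : N ⋊[δ] PosReal) (f : Lp H 2 PosReal.haar) :
    T.tildeFun hδ (g * h) f = T.tildeFun hδ g (T.tildeFun hδ h f) := by
  refine Lp.ext ?_
  filter_upwards [T.coeFn_tildeFun hδ (g * h) f, T.coeFn_tildeFun hδ g (T.tildeFun hδ h f),
    ae_mul_right g.right (T.coeFn_tildeFun hδ h f)] with r h1 h2 h3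
  rw [h1, h2, h3]
  simp [map_mul, mul_assoc]

theorem tildeFun_add (g : N ⋊[δ] PosReal) (f f' : Lp H 2 PosReal.haar) :
    T.tildeFun hδ g (f + f') = T.tildeFun hδ g f + T.tildeFun hδ g f' := by
  refine Lp.ext ?_
  filter_upwards [T.coeFn_tildeFun hδ g (f + f'), T.coeFn_tildeFun hδ g f,
    T.coeFn_tildeFun hδ g f', ae_mul_right g.right (Lp.coeFn_add f f'),
    Lp.coeFn_add (T.tildeFun hδ g f) (T.tildeFun hδ g f')] with r h1 h2 h3 h4 h5
  rw [h1, h5, h4, Pi.add_apply, Pi.add_apply, h2, h3, map_add]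

theorem tildeFun_smul (g : N ⋊[δ] PosReal) (c : ℂ) (f : Lp H 2 PosReal.haar) :
    T.tildeFun hδ g (c • f) = c • T.tildeFun hδ g f := by
  refine Lp.ext ?_
  filter_upwards [T.coeFn_tildeFun hδ g (c • f), T.coeFn_tildeFun hδ g f,
    ae_mul_right g.right (Lp.coeFn_smul c f),
    Lp.coeFn_smul c (T.tildeFun hδ g f)] with r h1 h2 h3 h4
  rw [h1, h4, h3, Pi.smul_apply, Pi.smul_apply, h2, map_smul]

theorem norm_tildeFun (g : N ⋊[δ] PosReal) (f : Lp H 2 PosReal.haar) :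
    ‖T.tildeFun hδ g f‖ = ‖f‖ := by
  have h := PosReal.measurePreserving_mul_right g.right
  rw [tildeFun, Lp.norm_toLp, Lp.norm_def, ← eLpNorm_comp_measurePreserving (Lp.memLp f).1 h]
  congr 1
  exact eLpNorm_congr_norm_ae (.of_forall fun r => by simp)

/-- `T̃` as a homomorphism to the group of unitary operators. -/
noncomputable def tildeHom : (N ⋊[δ] PosReal) →*
    (Lp H 2 PosReal.haar ≃ₗᵢ[ℂ] Lp H 2 PosReal.haar) where
  toFun g :=
    { toFun := T.tildeFun hδ g
      invFun := T.tildeFun hδ g⁻¹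
      left_inv := fun f => by rw [← tildeFun_mul, inv_mul_cancel, tildeFun_one]
      right_inv := fun f => by rw [← tildeFun_mul, mul_inv_cancel, tildeFun_one]
      map_add' := T.tildeFun_add hδ g
      map_smul' := T.tildeFun_smul hδ g
      norm_map' := T.norm_tildeFun hδ g }
  map_one' := LinearIsometryEquiv.ext (T.tildeFun_one hδ)
  map_mul' g h := LinearIsometryEquiv.ext (T.tildeFun_mul hδ g h)

theorem continuous_tildeFun_left [FirstCountableTopology N] (f : Lp H 2 PosReal.haar) :
    Continuous fun n : N => T.tildeFun hδ ⟨n, 1⟩ f := by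
  rw [continuous_iff_continuousAt]
  intro n₀
  rw [ContinuousAt]
  simp only [tildeFun]
  rw [Lp.tendsto_Lp_iff_tendsto_eLpNorm'']
  simp only [mul_one]
  have hmeas : ∀ n : N, AEStronglyMeasurable ((fun r => T.op (δ r n) (f r)) -
      fun r => T.op (δ r n₀) (f r)) PosReal.haar := fun n =>
    (T.aestronglyMeasurable_op hδ n (Lp.memLp f).1).sub
      (T.aestronglyMeasurable_op hδ n₀ (Lp.memLp f).1)
  have key : Filter.Tendsto (fun n : N => ∫⁻ r, ‖((fun r => T.op (δ r n) (f r)) -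
      fun r => T.op (δ r n₀) (f r)) r‖ₑ ^ (2 : ℝ) ∂PosReal.haar) (nhds n₀) (nhds 0) := by
    have h0 : ∫⁻ _ : PosReal, (0 : ENNReal) ∂PosReal.haar = 0 := lintegral_zero
    rw [← h0]
    refine tendsto_lintegral_filter_of_dominated_convergence'
      (fun r => (2 * ‖f r‖ₑ) ^ (2 : ℝ)) (.of_forall fun n => (hmeas n).enorm.pow_const _)
      (.of_forall fun n => .of_forall fun r => ?_) ?_ (.of_forall fun r => ?_)
    · refine ENNReal.rpow_le_rpow ?_ (by norm_num)
      refine (enorm_sub_le).trans ?_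
      rw [two_mul]
      simp
    · have h2 : ∀ r, (2 * ‖f r‖ₑ) ^ (2 : ℝ) = 2 ^ (2 : ℝ) * ‖f r‖ₑ ^ (2 : ℝ) := fun r =>
        ENNReal.mul_rpow_of_nonneg _ _ (by norm_num)
      simp only [h2]
      rw [lintegral_const_mul' _ _ (by simp)]
      refine ENNReal.mul_ne_top (by simp) ?_
      have h3 := lintegral_rpow_enorm_lt_top_of_eLpNorm_lt_top (p := 2) (by simp) (by simp)
        (Lp.memLp f).2
      simpa using h3.ne
    · have h4 : Continuous fun n : N =>
          ‖T.op (δ r n) (f r) - T.op (δ r n₀) (f r)‖ₑ ^ (2 : ℝ) := by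
        have h5 : Continuous fun n : N => T.op (δ r n) (f r) :=
          (T.continuous_op (f r)).comp (hδ.comp (continuous_const.prodMk continuous_id))
        exact ENNReal.continuous_rpow_const.comp (h5.sub continuous_const).enorm
      have h6 := h4.tendsto n₀
      simpa using h6
  have key2 := (ENNReal.continuous_rpow_const (y := 1 / 2)).tendsto 0 |>.comp key
  simp only [eLpNorm_eq_lintegral_rpow_enorm_toReal two_ne_zero ENNReal.ofNat_ne_top]
  simpa [Function.comp_def] using key2

theorem continuous_tildeFun [FirstCountableTopology N] (f : Lp H 2 PosReal.haar) :
    Continuous fun g : N ⋊[δ] PosReal => T.tildeFun hδ g f := by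
  have h1 : ∀ g : N ⋊[δ] PosReal, T.tildeFun hδ g f =
      T.tildeFun hδ ⟨g.left, 1⟩ (T.tildeFun hδ ⟨1, g.right⟩ f) := by
    intro g
    rw [← tildeFun_mul]
    congr 1
    ext <;> simp
  have h2 : Continuous fun p : N × Lp H 2 PosReal.haar => T.tildeFun hδ ⟨p.1, 1⟩ p.2 :=
    continuous_prod_of_continuous_lipschitzWith' _ 1
      (fun n => (T.tildeHom hδ ⟨n, 1⟩).isometry.lipschitz) (T.continuous_tildeFun_left hδ)
  have hg : Continuous fun g : N ⋊[δ] PosReal => (g.left, g.right) := continuous_induced_dom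
  have h3 : Continuous fun s : PosReal => T.tildeFun hδ ⟨1, s⟩ f := by
    have h4 : ∀ s : PosReal, T.tildeFun hδ ⟨1, s⟩ f = Lp.compMeasurePreserving
        (⟨fun r => r * s, PosReal.continuous_mul_right s⟩ : C(PosReal, PosReal))
        (PosReal.measurePreserving_mul_right s) f := by
      intro s
      refine Lp.ext ?_
      filter_upwards [T.coeFn_tildeFun hδ ⟨1, s⟩ f,
        Lp.coeFn_compMeasurePreserving f (PosReal.measurePreserving_mul_right s)] with r h5 h6
      rw [h5]
      refine Eq.trans ?_ h6.symm
      simp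
    simp only [h4]
    refine Continuous.compMeasurePreservingLp continuous_const ?_ _ ENNReal.ofNat_ne_top
    refine ContinuousMap.continuous_of_continuous_uncurry _ ?_
    exact Continuous.subtype_mk ((continuous_subtype_val.comp continuous_snd).mul
      (continuous_subtype_val.comp continuous_fst)) _
  have h7 := h2.comp ((continuous_fst.comp hg).prodMk (h3.comp (continuous_snd.comp hg)))
  exact h7.congr fun g => (h1 g).symm

/-- The unitary representation `T̃` of `ℝ*₊ ⋉ N` in `∫ H d*r` associated with the unitary
representation `T` of `N`: `(T̃ n f) r = T_r n (f r)` for `n ∈ N`, where `T_r n = T (δ r n)`, and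
`(T̃ r₀ f) r = f (r r₀)` for `r₀ ∈ ℝ*₊`. -/
noncomputable def tilde [FirstCountableTopology N] :
    UnitaryRep (N ⋊[δ] PosReal) (Lp H 2 PosReal.haar) where
  op := T.tildeHom hδ
  continuous_op := T.continuous_tildeFun hδ

end Tilde

end UnitaryRep

namespace LieGrading

variable {L : Type*} [LieRing L] [LieAlgebra ℝ L] [LieRing.IsNilpotent L] (𝒢 : LieGrading L)

theorem continuous_dilation : Continuous fun p : PosReal × 𝒢.N => 𝒢.dilation p.1 p.2 := by
  let _ : TopologicalSpace L := moduleTopology ℝ L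
  have : IsModuleTopology ℝ L := ⟨rfl⟩
  have : ContinuousAdd L := IsModuleTopology.toContinuousAdd ℝ L
  have : ContinuousSMul ℝ L := IsModuleTopology.toContinuousSMul ℝ L
  have hlog : Continuous (N.log : 𝒢.N → L) := continuous_induced_dom
  rw [continuous_induced_rng]
  change Continuous fun p : PosReal × 𝒢.N => 𝒢.dil p.1 p.2.log
  simp only [dil, scale, LinearMap.sum_apply, LinearMap.smul_apply]
  refine continuous_finsetSum _ fun k _ => ?_
  exact ((continuous_subtype_val.comp continuous_fst).pow k).smul
    ((IsModuleTopology.continuous_of_linearMap (𝒢.proj k)).comp (hlog.comp continuous_snd))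

instance [FiniteDimensional ℝ L] : FirstCountableTopology 𝒢.N := by
  let _ : TopologicalSpace L := moduleTopology ℝ L
  have : IsModuleTopology ℝ L := ⟨rfl⟩
  have : ContinuousAdd L := IsModuleTopology.toContinuousAdd ℝ L
  have : ContinuousSMul ℝ L := IsModuleTopology.toContinuousSMul ℝ L
  let e : L ≃ₗ[ℝ] (Fin (Module.finrank ℝ L) → ℝ) := (Module.finBasis ℝ L).equivFun
  let e' : L ≃ₜ (Fin (Module.finrank ℝ L) → ℝ) :=
    { e.toEquiv with
      continuous_toFun := IsModuleTopology.continuous_of_linearMap e.toLinearMap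
      continuous_invFun := e.symm.toLinearMap.continuous_on_pi }
  have : FirstCountableTopology L := e'.isInducing.firstCountableTopology
  exact (Topology.IsInducing.induced (N.log : 𝒢.N → L)).firstCountableTopology

/-- The unitary representation `T̃` of `G = ℝ*₊ ⋉ N` associated with the unitary representation `T`
of `N`. -/
noncomputable def tilde [FiniteDimensional ℝ L] {H : Type*} [NormedAddCommGroup H]
    [InnerProductSpace ℂ H] (T : UnitaryRep 𝒢.N H) :
    UnitaryRep (𝒢.N ⋊[𝒢.dilation] PosReal) (Lp H 2 PosReal.haar) :=
  T.tilde 𝒢.continuous_dilation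

end LieGrading

/-!
The argument has three ingredients.

*An affine model of `N`.* The orbit of `D` under `exp (ad L)` is the whole hyperplane `L + D` of
`L ⊕ ℝ D`, so that `N` acts simply transitively on `L` by affine maps with unipotent linear part
(`LieGrading.affAct`). In the chart of `N` given by this action (`LieGrading.chart`), left
translations are affine and preserve Lebesgue measure, and the displacement of a point under `x`
is of order `log x`. Averaging a unitary representation `T` of `N` against a Lipschitz bump function
in this chart yields `h ≠ 0` with `‖T x h - h‖ ≤ C ‖log x‖` (`LieGrading.exists_lipschitz_vector`).

*Summability and the cocycle.* All degrees of the grading are positive, so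
`‖T_r x h - h‖ = O(r)` as `r → 0`, whereas this norm is at most `2 ‖h‖` for all `r`. Since `r`
is integrable with respect to `d*r` near `0`, the vector `h` is almost invariant for every
admissible measure dominated by `d*r` (`LieGrading.isSummable`). For the same reason the formal
coboundary of `ξ r = cutoff r • h` is square integrable and continuous, although `ξ` is not square
integrable; if it were the coboundary of `f`, then `f r - ξ r` would be invariant under `T_r` for almost all
`r`, whence `f = ξ`, a contradiction (`LieGrading.isSpecial_tilde`).

*Irreducibility.* Let `k` be the largest degree such that `T` is nontrivial on the elements of
degree at least `k`. These are central modulo the kernel of `T`, so by Schur's lemma some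
`z ∈ R_k` satisfies `T (exp (t z)) = χ t` with a nontrivial character `χ` of `ℝ`
(`LieGrading.exists_character`). Hence `T_r (exp (t z)) = χ (t r ^ k)`. If `f` lies in a closed
invariant subspace and `g` in its orthogonal complement, then
`∫ χ (t r ^ k) ⟪g r, T_r x (f (r s))⟫ d*r = 0` for all `t`, and Fourier uniqueness makes the inner
product vanish for almost all `r`, first for countably many and then for all `x ∈ N`. As `T` is
irreducible, `f (r s) = 0` or `g r = 0`, for every `s` and almost every `r`; by Fubini's theorem
`f = 0` or `g = 0` (`LieGrading.isIrreducible_tilde`).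
-/

namespace LieGrading

/-! ### An affine model of the group -/

attribute [local instance 100] LieRing.ofAssociativeRing

variable {L : Type*} [LieRing L] [LieAlgebra ℝ L] (𝒢 : LieGrading L)

theorem continuous_log [TopologicalSpace L] [IsModuleTopology ℝ L] :
    Continuous (N.log : 𝒢.N → L) := by
  have h : ‹TopologicalSpace L› = moduleTopology ℝ L := eq_moduleTopology ℝ L
  subst h
  exact continuous_induced_dom

theorem continuous_N_iff [TopologicalSpace L] [IsModuleTopology ℝ L] {X : Type*}
    [TopologicalSpace X] {f : X → 𝒢.N} : Continuous f ↔ Continuous fun x => (f x).log := by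
  have h : ‹TopologicalSpace L› = moduleTopology ℝ L := eq_moduleTopology ℝ L
  subst h
  exact continuous_induced_rng

theorem sub_sum_proj_mem_tail (a : L) (k : ℕ) :
    a - ∑ j ∈ Finset.range k, 𝒢.proj j a ∈ 𝒢.tail k := by
  rw [mem_tail]
  intro j hj
  rw [map_sub, map_sum, sub_eq_zero]
  simp only [𝒢.proj_of_mem (𝒢.proj_mem _ a)]
  simp [hj]

variable [LieRing.IsNilpotent L]

/-- The action of `exp a` on the affine hyperplane `L + D` of `L ⊕ ℝ D`, identified with `L`. It is
an affine map of `L` with unipotent linear part. -/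
noncomputable def affAct (a y : L) : L := (𝒢.expAd a ⟨y, 1⟩).left

theorem expAd_mk_one (a y : L) : 𝒢.expAd a ⟨y, 1⟩ = ⟨𝒢.affAct a y, 1⟩ :=
  LieAlgebra.SemiDirectSum.ext rfl (𝒢.expAd_right a _)

theorem affAct_mul (x y : 𝒢.N) (z : L) :
    𝒢.affAct (x * y).log z = 𝒢.affAct x.log (𝒢.affAct y.log z) := by
  rw [affAct, expAd_mul, Module.End.mul_apply, expAd_mk_one, expAd_mk_one]

theorem affAct_injective {a b : L} (h : 𝒢.affAct a 0 = 𝒢.affAct b 0) : a = b := by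
  refine 𝒢.expAd_elD_injective ?_
  rw [elD, expAd_mk_one, expAd_mk_one, h]

/-- The orbit map `a ↦ exp a • 0` of the affine action is a bijection; `chart` is its inverse, in
which left translations of `N` are affine maps. -/
noncomputable def chart (y : L) : 𝒢.N := ⟨(𝒢.exists_expAd_elD y).choose⟩

theorem affAct_chart (y : L) : 𝒢.affAct (𝒢.chart y).log 0 = y := by
  rw [affAct]
  exact congrArg LieAlgebra.SemiDirectSum.left (𝒢.exists_expAd_elD y).choose_spec

theorem chart_affAct (x : 𝒢.N) : 𝒢.chart (𝒢.affAct x.log 0) = x :=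
  N.ext (𝒢.affAct_injective (𝒢.affAct_chart _))

theorem mul_chart (x : 𝒢.N) (y : L) : x * 𝒢.chart y = 𝒢.chart (𝒢.affAct x.log y) := by
  rw [← 𝒢.chart_affAct (x * 𝒢.chart y), affAct_mul, affAct_chart]

theorem affAct_one (y : L) : 𝒢.affAct (1 : 𝒢.N).log y = y := by
  change 𝒢.affAct 0 y = y
  rw [affAct, expAd_zero]
  rfl

theorem affAct_inv (x : 𝒢.N) (y : L) : 𝒢.affAct x.log (𝒢.affAct x⁻¹.log y) = y := by
  rw [← affAct_mul, mul_inv_cancel, affAct_one]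

theorem adE_pow_succ_mk (a y : L) (t : ℝ) (i : ℕ) :
    (𝒢.adE a ^ (i + 1)) ⟨y, t⟩ = ⟨(LieModule.toEnd ℝ L L a ^ i) (⁅a, y⁆ - t • 𝒢.D a), 0⟩ := by
  induction i with
  | zero => simp [adE_apply]
  | succ i ih =>
    rw [pow_succ', Module.End.mul_apply, ih, adE_apply, pow_succ', Module.End.mul_apply]
    simp

/-- The displacement of the affine action as a function that is linear in one of the two
occurrences of `a`. -/
noncomputable def displ (a y b : L) : L := ∑ i ∈ Finset.range 𝒢.cls,
  ((i + 1).factorial : ℝ)⁻¹ • (LieModule.toEnd ℝ L L a ^ i) (⁅b, y⁆ - 𝒢.D b)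

theorem left_sum {ι : Type*} (s : Finset ι) (f : ι → 𝒢.Ext) :
    (∑ i ∈ s, f i).left = ∑ i ∈ s, (f i).left := by
  classical
  induction s using Finset.induction_on with
  | empty => rfl
  | insert i s hi ih => rw [Finset.sum_insert hi, Finset.sum_insert hi, ← ih]; rfl

theorem expAd_left (a y : L) (t : ℝ) : (𝒢.expAd a ⟨y, t⟩).left = y + ∑ i ∈ Finset.range 𝒢.cls,
    ((i + 1).factorial : ℝ)⁻¹ • (LieModule.toEnd ℝ L L a ^ i) (⁅a, y⁆ - t • 𝒢.D a) := by
  rw [expAd_eq_sum, Finset.sum_range_succ', LinearMap.add_apply, LinearMap.sum_apply]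
  have h : ∀ i ∈ Finset.range 𝒢.cls, (((i + 1).factorial : ℚ)⁻¹ • 𝒢.adE a ^ (i + 1)) ⟨y, t⟩ =
      (⟨((i + 1).factorial : ℝ)⁻¹ • (LieModule.toEnd ℝ L L a ^ i) (⁅a, y⁆ - t • 𝒢.D a), 0⟩ :
        𝒢.Ext) := by
    intro i _
    change ((i + 1).factorial : ℚ)⁻¹ • (𝒢.adE a ^ (i + 1)) ⟨y, t⟩ = _
    rw [adE_pow_succ_mk, rat_smul_eq, smul_mk]
    simp
  rw [Finset.sum_congr rfl h, LieAlgebra.SemiDirectSum.add_eq_mk, left_sum]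
  simp [add_comm]

theorem affAct_eq (a y : L) : 𝒢.affAct a y = y + 𝒢.displ a y a := by
  rw [affAct, expAd_left, displ]
  simp

theorem displ_smul (a y b : L) (t : ℝ) : 𝒢.displ a y (t • b) = t • 𝒢.displ a y b := by
  simp only [displ, Finset.smul_sum]
  refine Finset.sum_congr rfl fun i _ => ?_
  rw [smul_lie, map_smul, ← smul_sub, map_smul, smul_comm]

/-- The linear part of the affine action. -/
noncomputable def linAct (a : L) : L →ₗ[ℝ] L where
  toFun y := (𝒢.expAd a ⟨y, 0⟩).left
  map_add' y z := by
    have : (⟨y + z, 0⟩ : 𝒢.Ext) = ⟨y, 0⟩ + ⟨z, 0⟩ := by simp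
    rw [this, map_add]; rfl
  map_smul' t y := by
    have : (⟨t • y, 0⟩ : 𝒢.Ext) = t • ⟨y, 0⟩ := by simp
    rw [this, map_smul]; rfl

theorem affAct_eq_linAct (a y : L) : 𝒢.affAct a y = 𝒢.linAct a y + 𝒢.affAct a 0 := by
  have : (⟨y, 1⟩ : 𝒢.Ext) = ⟨y, 0⟩ + ⟨0, 1⟩ := by simp
  rw [affAct, this, map_add]; rfl

/-- The linear part of the affine action is unipotent. -/
theorem isNilpotent_linAct_sub_one (a : L) : IsNilpotent (𝒢.linAct a - 1) := by
  have h1 : ∀ k, ∀ y ∈ 𝒢.tail k, (𝒢.linAct a - 1) y ∈ 𝒢.tail (k + 1) := fun k y hy =>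
    (𝒢.expAd_sub_self_mem a (k := k) (x := ⟨y, 0⟩) ⟨hy, rfl⟩).1
  have h2 : ∀ k y, ((𝒢.linAct a - 1) ^ k) y ∈ 𝒢.tail (k + 1) := by
    intro k y
    induction k with
    | zero => exact 𝒢.mem_tail_one _
    | succ k ih => rw [pow_succ', Module.End.mul_apply]; exact h1 _ _ ih
  exact ⟨𝒢.cls, LinearMap.ext fun y => 𝒢.eq_zero_of_mem_tail (Nat.lt_succ_self _) (h2 _ y)⟩

theorem det_linAct [FiniteDimensional ℝ L] (a : L) : LinearMap.det (𝒢.linAct a) = 1 := by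
  have h := (𝒢.isNilpotent_linAct_sub_one a).neg.charpoly_eq_X_pow_finrank
  have h2 := LinearMap.eval_charpoly (-(𝒢.linAct a - 1)) 1
  rw [h] at h2
  simpa using h2.symm

/-- The orbit map is triangular with respect to the grading, which determines the components of its
inverse recursively. -/
theorem smul_proj_log (a : L) (k : ℕ) : (k : ℝ) • 𝒢.proj k a =
    𝒢.proj k (𝒢.affAct (∑ j ∈ Finset.range k, 𝒢.proj j a) 0) - 𝒢.proj k (𝒢.affAct a 0) := by
  set a' := ∑ j ∈ Finset.range k, 𝒢.proj j a with ha'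
  have hb := 𝒢.sub_sum_proj_mem_tail a k
  have h := (𝒢.expAd_add_sub a' hb 𝒢.elD).1
  rw [← ha', add_sub_cancel, adE_apply] at h
  have h2 : 𝒢.proj k (𝒢.affAct a 0 - 𝒢.affAct a' 0 - (⁅a - a', (0 : L)⁆ - (1 : ℝ) • 𝒢.D (a - a')))
      = 0 := 𝒢.mem_tail.1 h k (Nat.lt_succ_self k)
  have h3 : 𝒢.proj k a' = 0 := by
    simp only [ha', map_sum, 𝒢.proj_of_mem (𝒢.proj_mem _ a)]
    simp
  rw [lie_zero, one_smul, zero_sub, sub_neg_eq_add, map_add, map_sub, D_apply, proj_scale, map_sub,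
    h3, sub_zero] at h2
  rw [eq_sub_iff_add_eq, ← sub_eq_zero]
  refine Eq.trans ?_ h2
  abel

section Topology

variable [TopologicalSpace L] [IsModuleTopology ℝ L]

theorem continuous_displ [FiniteDimensional ℝ L] :
    Continuous fun p : L × L × L => 𝒢.displ p.1 p.2.1 p.2.2 := by
  have : ContinuousAdd L := IsModuleTopology.toContinuousAdd ℝ L
  have : IsTopologicalAddGroup L := IsModuleTopology.topologicalAddGroup ℝ L
  have : ContinuousSMul ℝ L := IsModuleTopology.toContinuousSMul ℝ L
  have hl : Continuous fun p : L × L => ⁅p.1, p.2⁆ :=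
    IsModuleTopology.continuous_bilinear_of_finite_left
      (LieModule.toEnd ℝ L L : L →ₗ[ℝ] L →ₗ[ℝ] L)
  simp only [displ]
  refine continuous_finsetSum _ fun i hi => Continuous.const_smul ?_ _
  clear hi
  induction i with
  | zero =>
    have hD : Continuous 𝒢.D := IsModuleTopology.continuous_of_linearMap 𝒢.D.toLinearMap
    simp only [pow_zero, Module.End.one_apply]
    refine Continuous.sub ?_ (hD.comp (continuous_snd.comp continuous_snd))
    exact hl.comp ((continuous_snd.comp continuous_snd).prodMk
      (continuous_fst.comp continuous_snd))
  | succ i ih =>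
    simp only [pow_succ', Module.End.mul_apply, LieModule.toEnd_apply_apply]
    exact hl.comp (continuous_fst.prodMk ih)

theorem continuous_affAct [FiniteDimensional ℝ L] :
    Continuous fun p : L × L => 𝒢.affAct p.1 p.2 := by
  have : ContinuousAdd L := IsModuleTopology.toContinuousAdd ℝ L
  simp only [affAct_eq]
  exact continuous_snd.add (𝒢.continuous_displ.comp
    (continuous_fst.prodMk (continuous_snd.prodMk continuous_fst)))

theorem continuous_affAct_zero [FiniteDimensional ℝ L] : Continuous fun a => 𝒢.affAct a 0 :=
  𝒢.continuous_affAct.comp (g := fun p : L × L => 𝒢.affAct p.1 p.2)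
    (f := fun a => (a, 0)) (continuous_id.prodMk continuous_const)

/-- The components of `chart y` depend continuously on `y`, by induction on the degree. -/
theorem continuous_chart [FiniteDimensional ℝ L] : Continuous 𝒢.chart := by
  have : ContinuousAdd L := IsModuleTopology.toContinuousAdd ℝ L
  have : IsTopologicalAddGroup L := IsModuleTopology.topologicalAddGroup ℝ L
  have : ContinuousSMul ℝ L := IsModuleTopology.toContinuousSMul ℝ L
  have hp : ∀ k, Continuous (𝒢.proj k) := fun k => IsModuleTopology.continuous_of_linearMap _
  have key : ∀ k, Continuous fun y => 𝒢.proj k (𝒢.chart y).log := by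
    intro k
    induction k using Nat.strong_induction_on with
    | _ k ih =>
      by_cases hk : k = 0
      · subst hk
        simp only [proj_zero]
        exact continuous_const
      have h : ∀ y, 𝒢.proj k (𝒢.chart y).log = (k : ℝ)⁻¹ • (𝒢.proj k (𝒢.affAct
          (∑ j ∈ Finset.range k, 𝒢.proj j (𝒢.chart y).log) 0) - 𝒢.proj k y) := by
        intro y
        have h1 := 𝒢.smul_proj_log (𝒢.chart y).log k
        rw [affAct_chart] at h1
        rw [← h1, smul_smul, inv_mul_cancel₀ (by exact_mod_cast hk), one_smul]
      simp only [h]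
      have h1 : Continuous fun y => ∑ j ∈ Finset.range k, 𝒢.proj j (𝒢.chart y).log :=
        continuous_finsetSum _ fun j hj => ih j (Finset.mem_range.1 hj)
      have h2 : Continuous fun a => 𝒢.affAct a 0 := 𝒢.continuous_affAct_zero
      have h3 := (hp k).comp (h2.comp h1)
      exact Continuous.const_smul (h3.sub (hp k)) _
  rw [continuous_N_iff]
  refine (continuous_finsetSum (Finset.range (𝒢.cls + 1)) fun k _ => key k).congr fun y => ?_
  exact 𝒢.sum_proj _

end Topology

theorem continuous_mul_left [FiniteDimensional ℝ L] (x : 𝒢.N) : Continuous fun y => x * y := by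
  let _ : TopologicalSpace L := moduleTopology ℝ L
  have : IsModuleTopology ℝ L := ⟨rfl⟩
  have h : ∀ y, x * y = 𝒢.chart (𝒢.affAct x.log (𝒢.affAct y.log 0)) := by
    intro y
    rw [← mul_chart, chart_affAct]
  simp only [h]
  have h1 : Continuous fun y : 𝒢.N => 𝒢.affAct y.log 0 :=
    𝒢.continuous_affAct_zero.comp 𝒢.continuous_log
  have h2 : Continuous fun y => 𝒢.affAct x.log y :=
    𝒢.continuous_affAct.comp (g := fun p : L × L => 𝒢.affAct p.1 p.2)
      (f := fun y => (x.log, y)) (continuous_const.prodMk continuous_id)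
  exact 𝒢.continuous_chart.comp (h2.comp h1)

end LieGrading

/-! ### Lipschitz vectors -/

namespace UnitaryRep

variable {G : Type*} [Group G] [TopologicalSpace G]
  {H : Type*} [NormedAddCommGroup H] [InnerProductSpace ℂ H] (T : UnitaryRep G H)

theorem norm_op_sub_le (g : G) (v : H) : ‖T.op g v - v‖ ≤ 2 * ‖v‖ := by
  refine (norm_sub_le _ _).trans ?_
  rw [LinearIsometryEquiv.norm_map, two_mul]

/-- A Gårding-type smoothing in a chart `q : V → G` in which `G` acts by the measure-preserving
maps `A g`: averaging `T (q y) v` against a Lipschitz bump function yields a nonzero vector whose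
orbit map is Lipschitz at `1`, with respect to a length function `ρ` that controls the displacement
of `A g`. -/
theorem exists_lipschitz_vector [CompleteSpace H] [Nontrivial H]
    {V : Type*} [NormedAddCommGroup V] [NormedSpace ℝ V] [FiniteDimensional ℝ V]
    [MeasurableSpace V] [BorelSpace V] (μ : Measure V) [μ.IsAddHaarMeasure]
    {q : V → G} (hq : Continuous q) (hq0 : q 0 = 1) {A : G → V → V}
    (hA : ∀ g, MeasurePreserving (A g) μ μ) (hAc : ∀ g, Continuous (A g))
    (hAq : ∀ g y, q (A g y) = g * q y) (hAinv : ∀ g y, A g⁻¹ (A g y) = y)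
    {ρ : G → ℝ} (hρ : ∀ g, 0 ≤ ρ g) (hρinv : ∀ g, ρ g⁻¹ = ρ g)
    (hbound : ∀ R : ℝ, ∃ C, ∀ g, ρ g ≤ 1 → ∀ y, ‖y‖ ≤ R → ‖A g y - y‖ ≤ C * ρ g) :
    ∃ h : H, h ≠ 0 ∧ ∃ C, 0 ≤ C ∧ ∀ g, ‖T.op g h - h‖ ≤ C * ρ g := by
  obtain ⟨v, hv⟩ := exists_ne (0 : H)
  have hvpos : 0 < ‖v‖ := norm_pos_iff.2 hv
  have hc : Continuous fun y => T.op (q y) v := (T.continuous_op v).comp hq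
  obtain ⟨ε, hε, hεv⟩ : ∃ ε > 0, ∀ y, ‖y‖ < ε → ‖T.op (q y) v - v‖ < ‖v‖ / 2 := by
    have h := Metric.continuous_iff.1 hc 0 (‖v‖ / 2) (by positivity)
    simpa [hq0, dist_eq_norm] using h
  set φ : V → ℝ := fun y => max (ε - ‖y‖) 0 with hφ
  have hφc : Continuous φ := (continuous_const.sub continuous_norm).max continuous_const
  have hφ0 : ∀ y, 0 ≤ φ y := fun y => le_max_right _ _
  have hφs : ∀ y, ε ≤ ‖y‖ → φ y = 0 := fun y hy => max_eq_right (by linarith)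
  have hφl : ∀ y z, |φ y - φ z| ≤ ‖z - y‖ := by
    intro y z
    refine (abs_max_sub_max_le_abs _ _ _).trans ?_
    rw [sub_sub_sub_cancel_left]
    exact abs_norm_sub_norm_le z y
  have hφcs : HasCompactSupport φ := by
    refine HasCompactSupport.of_support_subset_isCompact (isCompact_closedBall 0 ε) fun y hy => ?_
    rw [mem_closedBall_zero_iff]
    by_contra hcon
    exact hy (hφs y (not_le.1 hcon).le)
  have hφint : Integrable φ μ := hφc.integrable_of_hasCompactSupport hφcs
  have hfc : Continuous fun y => φ y • T.op (q y) v := hφc.smul hc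
  have hfint : Integrable (fun y => φ y • T.op (q y) v) μ :=
    hfc.integrable_of_hasCompactSupport hφcs.smul_right
  set h : H := ∫ y, φ y • T.op (q y) v ∂μ with hh
  have hpos : 0 < ∫ y, φ y ∂μ := by
    refine hφc.integral_pos_of_hasCompactSupport_nonneg_nonzero hφcs hφ0 (x := 0) ?_
    simp [hφ, hε.le, hε.ne']
  refine ⟨h, ?_, ?_⟩
  · intro h0
    have h1 : h - (∫ y, φ y ∂μ) • v = ∫ y, φ y • (T.op (q y) v - v) ∂μ := by
      simp only [smul_sub]
      rw [integral_sub hfint (hφint.smul_const v), integral_smul_const]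
    have h2 : ‖h - (∫ y, φ y ∂μ) • v‖ ≤ ∫ y, φ y * (‖v‖ / 2) ∂μ := by
      rw [h1]
      refine norm_integral_le_of_norm_le (hφint.mul_const _) (.of_forall fun y => ?_)
      rw [norm_smul, Real.norm_of_nonneg (hφ0 y)]
      by_cases hy : ‖y‖ < ε
      · exact mul_le_mul_of_nonneg_left (hεv y hy).le (hφ0 y)
      · simp [hφs y (not_lt.1 hy)]
    rw [integral_mul_const, h0, zero_sub, norm_neg, norm_smul, Real.norm_of_nonneg hpos.le] at h2
    nlinarith [mul_pos hpos hvpos]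
  · obtain ⟨C, hC⟩ := hbound ε
    have hC' : ∀ g, ρ g ≤ 1 → ∀ y, ‖y‖ ≤ ε → ‖A g y - y‖ ≤ |C| * ρ g := fun g hg y hy =>
      (hC g hg y hy).trans (mul_le_mul_of_nonneg_right (le_abs_self C) (hρ g))
    set B : Set V := Metric.closedBall 0 (ε + |C|) with hB
    -- For `ρ g ≤ 1` the difference `φ y - φ (A g y)` is supported in `B`.
    have key : ∀ g, ρ g ≤ 1 → ∀ y, ‖φ y - φ (A g y)‖ ≤ B.indicator (fun _ => |C| * ρ g) y := by
      intro g hg y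
      have hCρ : |C| * ρ g ≤ |C| := mul_le_of_le_one_right (abs_nonneg C) hg
      have hnn : 0 ≤ |C| * ρ g := mul_nonneg (abs_nonneg C) (hρ g)
      have hmain : ‖A g y - y‖ ≤ |C| * ρ g → ‖y‖ ≤ ε + |C| →
          ‖φ y - φ (A g y)‖ ≤ B.indicator (fun _ => |C| * ρ g) y := by
        intro h1 h2
        rw [Set.indicator_of_mem (by rwa [hB, mem_closedBall_zero_iff]), Real.norm_eq_abs]
        exact (hφl _ _).trans h1
      by_cases hy : ‖y‖ ≤ ε
      · exact hmain (hC' g hg y hy) (by linarith [abs_nonneg C])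
      by_cases hy' : ‖A g y‖ ≤ ε
      · have h1 := hC' g⁻¹ (by rwa [hρinv]) (A g y) hy'
        rw [hAinv, hρinv, norm_sub_rev] at h1
        refine hmain h1 ?_
        have h2 := norm_sub_norm_le y (A g y)
        rw [norm_sub_rev] at h2
        linarith
      · rw [hφs y (not_le.1 hy).le, hφs _ (not_le.1 hy').le, sub_zero, norm_zero]
        exact Set.indicator_nonneg (fun _ _ => hnn) y
    have hBfin : μ B ≠ ⊤ := (isCompact_closedBall 0 _).measure_lt_top.ne
    refine ⟨max (μ.real B * |C| * ‖v‖) (2 * ‖h‖), le_max_of_le_right (by positivity),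
      fun g => ?_⟩
    by_cases hg : ρ g ≤ 1
    · have h1 : T.op g h = ∫ y, φ y • T.op (q (A g y)) v ∂μ := by
        have h2 := ((T.op g : H ≃L[ℂ] H) : H →L[ℂ] H).integral_comp_comm hfint
        rw [hh]
        refine Eq.trans h2.symm (integral_congr_ae (.of_forall fun y => ?_))
        simp only [hAq, map_mul]
        exact (((T.op g : H ≃L[ℂ] H) : H →L[ℂ] H).restrictScalars ℝ).map_smul _ _
      have h2 : h = ∫ y, φ (A g y) • T.op (q (A g y)) v ∂μ := by
        have h3 := integral_map (μ := μ) (hA g).measurable.aemeasurable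
          (f := fun y => φ y • T.op (q y) v)
          ((hA g).map_eq.symm ▸ hfc.aestronglyMeasurable)
        rwa [(hA g).map_eq] at h3
      have hcA : Continuous fun y => T.op (q (A g y)) v := hc.comp (hAc g)
      have hint1 : Integrable (fun y => φ y • T.op (q (A g y)) v) μ :=
        (hφc.smul hcA).integrable_of_hasCompactSupport hφcs.smul_right
      have hint2 : Integrable (fun y => φ (A g y) • T.op (q (A g y)) v) μ :=
        (hA g).integrable_comp_of_integrable hfint
      have h4 : T.op g h - h = ∫ y, (φ y - φ (A g y)) • T.op (q (A g y)) v ∂μ := by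
        rw [h1]
        conv_lhs => rw [h2]
        rw [← integral_sub hint1 hint2]
        simp only [sub_smul]
      have h5 : ‖T.op g h - h‖ ≤ ∫ y, B.indicator (fun _ => |C| * ρ g) y * ‖v‖ ∂μ := by
        rw [h4]
        refine norm_integral_le_of_norm_le (Integrable.mul_const ?_ _) (.of_forall fun y => ?_)
        · exact (integrable_indicator_iff Metric.isClosed_closedBall.measurableSet).2
            (integrableOn_const hBfin)
        · rw [norm_smul, LinearIsometryEquiv.norm_map]
          exact mul_le_mul_of_nonneg_right (key g hg y) (norm_nonneg v)
      refine h5.trans ?_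
      rw [integral_mul_const, integral_indicator Metric.isClosed_closedBall.measurableSet,
        setIntegral_const, smul_eq_mul]
      refine le_trans (le_of_eq ?_) (mul_le_mul_of_nonneg_right (le_max_left _ _) (hρ g))
      ring
    · refine (T.norm_op_sub_le g h).trans ?_
      refine (le_max_right (μ.real B * |C| * ‖v‖) _).trans ?_
      exact le_mul_of_one_le_right (le_max_of_le_right (by positivity)) (not_le.1 hg).le

end UnitaryRep

namespace LieGrading

variable {L : Type*} [LieRing L] [LieAlgebra ℝ L] [LieRing.IsNilpotent L] (𝒢 : LieGrading L)

/-- A linear identification of `L` with a coordinate space, used to norm `L`. -/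
noncomputable def coord [FiniteDimensional ℝ L] (_ : LieGrading L) :
    L ≃ₗ[ℝ] (Fin (Module.finrank ℝ L) → ℝ) := (Module.finBasis ℝ L).equivFun

/-- On bounded sets the affine action moves points by a distance of order `a`: the displacement is
linear in one occurrence of `a` and continuous in the other. -/
theorem exists_displ_bound [FiniteDimensional ℝ L] (R : ℝ) :
    ∃ C, ∀ a y : L, ‖𝒢.coord a‖ ≤ 1 → ‖𝒢.coord y‖ ≤ R →
      ‖𝒢.coord (𝒢.affAct a y - y)‖ ≤ C * ‖𝒢.coord a‖ := by
  let _ : TopologicalSpace L := moduleTopology ℝ L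
  have : IsModuleTopology ℝ L := ⟨rfl⟩
  have : ContinuousAdd L := IsModuleTopology.toContinuousAdd ℝ L
  have : ContinuousSMul ℝ L := IsModuleTopology.toContinuousSMul ℝ L
  have he : Continuous 𝒢.coord := IsModuleTopology.continuous_of_linearMap 𝒢.coord.toLinearMap
  have he' : Continuous 𝒢.coord.symm := 𝒢.coord.symm.toLinearMap.continuous_on_pi
  let V := Fin (Module.finrank ℝ L) → ℝ
  have hf : Continuous fun p : V × V × V => 𝒢.coord (𝒢.displ (𝒢.coord.symm p.1)
      (𝒢.coord.symm p.2.1) (𝒢.coord.symm p.2.2)) :=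
    he.comp (𝒢.continuous_displ.comp (g := fun p : L × L × L => 𝒢.displ p.1 p.2.1 p.2.2)
      (f := fun p : V × V × V => (𝒢.coord.symm p.1, 𝒢.coord.symm p.2.1, 𝒢.coord.symm p.2.2))
      ((he'.comp continuous_fst).prodMk ((he'.comp (continuous_fst.comp continuous_snd)).prodMk
        (he'.comp (continuous_snd.comp continuous_snd)))))
  have hK : IsCompact (Metric.closedBall (0 : V) 1 ×ˢ Metric.closedBall (0 : V) R ×ˢ
      Metric.closedBall (0 : V) 1) :=
    (isCompact_closedBall _ _).prod ((isCompact_closedBall _ _).prod (isCompact_closedBall _ _))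
  obtain ⟨C, hC⟩ := hK.exists_bound_of_continuousOn hf.continuousOn
  refine ⟨C, fun a y ha hy => ?_⟩
  rw [affAct_eq, add_sub_cancel_left]
  by_cases h0 : ‖𝒢.coord a‖ = 0
  · have h1 : a = 0 := by simpa using h0
    have h2 := 𝒢.displ_smul a y 0 0
    rw [zero_smul, zero_smul] at h2
    subst h1
    simp [h2]
  · set t := ‖𝒢.coord a‖ with ht
    have htpos : 0 < t := lt_of_le_of_ne (norm_nonneg _) (Ne.symm h0)
    have h1 : a = t • (t⁻¹ • a) := by rw [smul_smul, mul_inv_cancel₀ h0, one_smul]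
    have h2 := hC (𝒢.coord a, 𝒢.coord y, 𝒢.coord (t⁻¹ • a)) (by
      refine ⟨by simpa using ha, by simpa using hy, ?_⟩
      rw [mem_closedBall_zero_iff]
      simp only [map_smul, norm_smul, norm_inv, ← ht, Real.norm_of_nonneg htpos.le]
      rw [inv_mul_cancel₀ h0])
    simp only [LinearEquiv.symm_apply_apply] at h2
    have h3 : 𝒢.displ a y a = t • 𝒢.displ a y (t⁻¹ • a) := by
      rw [← displ_smul, ← h1]
    rw [h3, map_smul, norm_smul, Real.norm_of_nonneg htpos.le, mul_comm]
    exact mul_le_mul_of_nonneg_right h2 htpos.le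

/-- The affine action preserves Lebesgue measure, its linear part having determinant `1`. -/
theorem measurePreserving_affAct [FiniteDimensional ℝ L] (a : L) :
    MeasurePreserving fun y => 𝒢.coord (𝒢.affAct a (𝒢.coord.symm y)) := by
  set f := 𝒢.coord.toLinearMap ∘ₗ 𝒢.linAct a ∘ₗ 𝒢.coord.symm.toLinearMap with hf
  have hdet : LinearMap.det f = 1 := by
    rw [hf, ← det_linAct 𝒢 a]
    exact LinearMap.det_conj (𝒢.linAct a) 𝒢.coord
  have h1 : MeasurePreserving f := by
    refine ⟨f.continuous_on_pi.measurable, ?_⟩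
    rw [Real.map_linearMap_volume_pi_eq_smul_volume_pi (by rw [hdet]; exact one_ne_zero), hdet]
    simp
  have h2 := (measurePreserving_add_right (volume : Measure (Fin (Module.finrank ℝ L) → ℝ))
    (𝒢.coord (𝒢.affAct a 0))).comp h1
  convert! h2 using 1
  funext y
  rw [affAct_eq_linAct, map_add]
  rfl

/-- A unitary representation of `N` in a nonzero space has a nonzero vector whose orbit map is
Lipschitz at `1` in exponential coordinates. -/
theorem exists_lipschitz_vector [FiniteDimensional ℝ L] {H : Type*} [NormedAddCommGroup H]
    [InnerProductSpace ℂ H] [CompleteSpace H] [Nontrivial H] (T : UnitaryRep 𝒢.N H) :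
    ∃ h : H, h ≠ 0 ∧ ∃ C, 0 ≤ C ∧ ∀ x, ‖T.op x h - h‖ ≤ C * ‖𝒢.coord x.log‖ := by
  let _ : TopologicalSpace L := moduleTopology ℝ L
  have : IsModuleTopology ℝ L := ⟨rfl⟩
  have : ContinuousAdd L := IsModuleTopology.toContinuousAdd ℝ L
  have : ContinuousSMul ℝ L := IsModuleTopology.toContinuousSMul ℝ L
  have he : Continuous 𝒢.coord := IsModuleTopology.continuous_of_linearMap 𝒢.coord.toLinearMap
  have he' : Continuous 𝒢.coord.symm := 𝒢.coord.symm.toLinearMap.continuous_on_pi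
  refine T.exists_lipschitz_vector volume (q := fun y => 𝒢.chart (𝒢.coord.symm y))
    (𝒢.continuous_chart.comp he') ?_ (A := fun x y => 𝒢.coord (𝒢.affAct x.log (𝒢.coord.symm y)))
    (fun x => 𝒢.measurePreserving_affAct x.log) (fun x => ?_) (fun x y => ?_) (fun x y => ?_)
    (ρ := fun x => ‖𝒢.coord x.log‖) (fun x => norm_nonneg _) (fun x => ?_) (fun R => ?_)
  · rw [map_zero, ← 𝒢.chart_affAct 1, affAct_one]
  · exact he.comp (𝒢.continuous_affAct.comp (g := fun p : L × L => 𝒢.affAct p.1 p.2)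
      (f := fun y => (x.log, 𝒢.coord.symm y)) (continuous_const.prodMk he'))
  · simp only [LinearEquiv.symm_apply_apply, mul_chart]
  · simp only [LinearEquiv.symm_apply_apply]
    have := 𝒢.affAct_inv x⁻¹ (𝒢.coord.symm y)
    rw [inv_inv] at this
    rw [this, LinearEquiv.apply_symm_apply]
  · change ‖𝒢.coord (-x.log)‖ = _
    rw [map_neg, norm_neg]
  · obtain ⟨C, hC⟩ := 𝒢.exists_displ_bound R
    refine ⟨C, fun x hx y hy => ?_⟩
    have := hC x.log (𝒢.coord.symm y) hx (by rwa [LinearEquiv.apply_symm_apply])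
    rwa [map_sub, LinearEquiv.apply_symm_apply] at this

end LieGrading

/-! ### Integrals over the multiplicative group of positive reals -/

namespace PosReal

theorem lintegral_Iic_pow_lt_top (R : ℝ) (p : ℕ) :
    ∫⁻ r in {r : PosReal | (r : ℝ) ≤ R}, ENNReal.ofReal ((r : ℝ) ^ (p + 1)) ∂haar < ⊤ := by
  have hs : MeasurableSet {r : PosReal | (r : ℝ) ≤ R} :=
    measurableSet_le measurable_subtype_coe measurable_const
  have hm : Measurable fun r : PosReal => ENNReal.ofReal ((r : ℝ) ^ (p + 1)) :=
    (measurable_subtype_coe.pow_const _).ennreal_ofReal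
  rw [← lintegral_indicator hs, lintegral_haar (hm.indicator hs)]
  have h1 : ∀ x : ℝ, (if h : 0 < x then ENNReal.ofReal x⁻¹ *
      {r : PosReal | (r : ℝ) ≤ R}.indicator (fun r => ENNReal.ofReal ((r : ℝ) ^ (p + 1)))
        (⟨x, h⟩ : PosReal) else 0) ≤
      (Set.Ioc 0 R).indicator (fun _ => ENNReal.ofReal (R ^ p)) x := by
    intro x
    by_cases hx : 0 < x
    · by_cases hxR : x ≤ R
      · rw [dif_pos hx, Set.indicator_of_mem (by exact hxR),
          Set.indicator_of_mem (by exact ⟨hx, hxR⟩), ← ENNReal.ofReal_mul (inv_nonneg.2 hx.le)]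
        refine ENNReal.ofReal_le_ofReal ?_
        change x⁻¹ * x ^ (p + 1) ≤ R ^ p
        rw [pow_succ', inv_mul_cancel_left₀ hx.ne']
        exact pow_le_pow_left₀ hx.le hxR p
      · rw [dif_pos hx, Set.indicator_of_notMem (by exact hxR)]
        simp
    · simp [hx]
  refine (lintegral_mono h1).trans_lt ?_
  rw [lintegral_indicator measurableSet_Ioc, setLIntegral_const]
  exact ENNReal.mul_lt_top ENNReal.ofReal_lt_top (by simp)

/-- The Haar measure is infinite near `0`. -/
theorem haar_Iic_one : haar {r : PosReal | (r : ℝ) ≤ 1} = ⊤ := by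
  have hs : MeasurableSet {r : PosReal | (r : ℝ) ≤ 1} :=
    measurableSet_le measurable_subtype_coe measurable_const
  rw [← lintegral_indicator_one hs, lintegral_haar (measurable_one.indicator hs)]
  have h1 : ∀ x : ℝ, (if h : 0 < x then ENNReal.ofReal x⁻¹ *
      {r : PosReal | (r : ℝ) ≤ 1}.indicator (1 : PosReal → ENNReal) (⟨x, h⟩ : PosReal) else 0) =
      (Set.Ioc 0 1).indicator (fun x : ℝ => ENNReal.ofReal x⁻¹) x := by
    intro x
    by_cases hx : 0 < x <;> by_cases hx1 : x ≤ 1 <;> simp [hx, hx1, Set.indicator]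
  simp only [h1]
  rw [lintegral_indicator measurableSet_Ioc]
  by_contra hne
  have h2 : IntegrableOn (fun x : ℝ => x⁻¹) (Set.Ioc 0 1) := by
    refine ⟨measurable_inv.aestronglyMeasurable, ?_⟩
    rw [hasFiniteIntegral_iff_enorm]
    refine lt_of_eq_of_lt ?_ (lt_top_iff_ne_top.2 hne)
    refine setLIntegral_congr_fun measurableSet_Ioc fun x hx => ?_
    exact Real.enorm_of_nonneg (inv_nonneg.2 hx.1.le)
  have h3 := (intervalIntegrable_iff_integrableOn_Ioc_of_le zero_le_one).2 h2
  rw [intervalIntegrable_inv_iff] at h3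
  simp at h3

/-- The truncated coordinate function `r`, `r ≤ R`, which dominates the cocycles below. -/
noncomputable def trunc (R : ℝ) (r : PosReal) : ℝ := if (r : ℝ) ≤ R then r else 0

theorem memLp_trunc (R : ℝ) : MemLp (trunc R) 2 haar := by
  have hs : MeasurableSet {r : PosReal | (r : ℝ) ≤ R} :=
    measurableSet_le measurable_subtype_coe measurable_const
  have hm : Measurable (trunc R) := Measurable.ite hs measurable_subtype_coe measurable_const
  refine ⟨hm.aestronglyMeasurable, ?_⟩
  rw [eLpNorm_lt_top_iff_lintegral_rpow_enorm_lt_top two_ne_zero ENNReal.ofNat_ne_top]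
  refine lt_of_eq_of_lt ?_ (lintegral_Iic_pow_lt_top R 1)
  rw [← lintegral_indicator hs]
  refine lintegral_congr fun r => ?_
  by_cases hr : (r : ℝ) ≤ R
  · rw [Set.indicator_of_mem (by exact hr), trunc, if_pos hr, Real.enorm_of_nonneg r.2.le,
      ENNReal.ofReal_pow r.2.le]
    simp
  · rw [Set.indicator_of_notMem (by exact hr), trunc, if_neg hr]
    simp

theorem weightMeasure_le_haar {u : ℝ → ℝ} (hu : ∀ r, 0 < r → 0 < u r) :
    UnitaryRep.weightMeasure u ≤ haar := by
  have h : UnitaryRep.weightMeasure u ≤ haar.withDensity 1 := by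
    refine withDensity_mono (.of_forall fun r => ?_)
    refine ENNReal.ofReal_le_one.2 (Real.exp_le_one_iff.2 ?_)
    have := hu r r.2
    linarith
  rwa [withDensity_one] at h

end PosReal

/-! ### Summability -/

namespace UnitaryRep

variable {N : Type*} [Group N] [TopologicalSpace N]
  {H : Type*} [NormedAddCommGroup H] [InnerProductSpace ℂ H] {T : UnitaryRep N H}

theorem NoInvariantVectors.comp_mulEquiv (hT : T.NoInvariantVectors) (δ : MulAut N) {v : H}
    (hv : ∀ g, T.op (δ g) v = v) : v = 0 :=
  hT v fun g => by simpa using hv (δ.symm g)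

end UnitaryRep

namespace LieGrading

variable {L : Type*} [LieRing L] [LieAlgebra ℝ L] (𝒢 : LieGrading L)

instance [FiniteDimensional ℝ L] : TopologicalSpace.SeparableSpace 𝒢.N := by
  let _ : TopologicalSpace L := moduleTopology ℝ L
  have : IsModuleTopology ℝ L := ⟨rfl⟩
  have : ContinuousAdd L := IsModuleTopology.toContinuousAdd ℝ L
  have : ContinuousSMul ℝ L := IsModuleTopology.toContinuousSMul ℝ L
  have hc : Continuous fun v => (⟨𝒢.coord.symm v⟩ : 𝒢.N) :=
    𝒢.continuous_N_iff.2 𝒢.coord.symm.toLinearMap.continuous_on_pi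
  refine DenseRange.separableSpace (Function.Surjective.denseRange fun x => ?_) hc
  exact ⟨𝒢.coord x.log, N.ext (𝒢.coord.symm_apply_apply _)⟩

theorem continuous_norm_coord_log [FiniteDimensional ℝ L] :
    Continuous fun x : 𝒢.N => ‖𝒢.coord x.log‖ := by
  let _ : TopologicalSpace L := moduleTopology ℝ L
  have : IsModuleTopology ℝ L := ⟨rfl⟩
  have he : Continuous 𝒢.coord := IsModuleTopology.continuous_of_linearMap 𝒢.coord.toLinearMap
  exact (he.comp 𝒢.continuous_log).norm

/-- All degrees of the grading being positive, dilations contract at least linearly. -/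
theorem exists_dil_bound [FiniteDimensional ℝ L] (R : ℝ) : ∃ K, 0 ≤ K ∧ ∀ r : PosReal,
    (r : ℝ) ≤ R → ∀ a : L, ‖𝒢.coord (𝒢.dil r a)‖ ≤ K * r * ‖𝒢.coord a‖ := by
  let P : ℕ → (Fin (Module.finrank ℝ L) → ℝ) →L[ℝ] (Fin (Module.finrank ℝ L) → ℝ) := fun k =>
    (𝒢.coord.toLinearMap ∘ₗ 𝒢.proj k ∘ₗ 𝒢.coord.symm.toLinearMap).toContinuousLinearMap
  have hP : ∀ k a, P k (𝒢.coord a) = 𝒢.coord (𝒢.proj k a) := by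
    intro k a
    change 𝒢.coord (𝒢.proj k (𝒢.coord.symm (𝒢.coord a))) = _
    rw [LinearEquiv.symm_apply_apply]
  have hM : (0 : ℝ) ≤ max 1 R := le_max_of_le_left zero_le_one
  refine ⟨∑ k ∈ Finset.range (𝒢.cls + 1), max 1 R ^ k * ‖P k‖,
    Finset.sum_nonneg fun k _ => by positivity, fun r hr a => ?_⟩
  rw [dil, scale, LinearMap.sum_apply, map_sum, Finset.sum_mul, Finset.sum_mul]
  refine norm_sum_le_of_le _ fun k _ => ?_
  rw [LinearMap.smul_apply, map_smul, norm_smul, Real.norm_of_nonneg (pow_nonneg r.2.le k)]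
  cases k with
  | zero =>
    rw [proj_zero, map_zero, norm_zero, mul_zero]
    have := r.2.le
    positivity
  | succ k =>
    have h1 : ‖𝒢.coord (𝒢.proj (k + 1) a)‖ ≤ ‖P (k + 1)‖ * ‖𝒢.coord a‖ := by
      rw [← hP]; exact (P (k + 1)).le_opNorm _
    have h2 : (r : ℝ) ^ (k + 1) ≤ max 1 R ^ (k + 1) * r := by
      rw [pow_succ]
      refine mul_le_mul_of_nonneg_right ?_ r.2.le
      exact (pow_le_pow_left₀ r.2.le (hr.trans (le_max_right _ _)) k).trans
        (pow_le_pow_right₀ (le_max_left _ _) (Nat.le_succ k))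
    have h3 : (0 : ℝ) ≤ max 1 R ^ (k + 1) * r := mul_nonneg (pow_nonneg hM _) r.2.le
    calc (r : ℝ) ^ (k + 1) * ‖𝒢.coord (𝒢.proj (k + 1) a)‖
        ≤ (max 1 R ^ (k + 1) * r) * (‖P (k + 1)‖ * ‖𝒢.coord a‖) :=
          mul_le_mul h2 h1 (norm_nonneg _) h3
      _ = _ := by ring

variable {𝒢} [LieRing.IsNilpotent L] {H : Type*} [NormedAddCommGroup H] [InnerProductSpace ℂ H] {T : UnitaryRep 𝒢.N H}

theorem exists_dilation_bound [FiniteDimensional ℝ L] {h : H} {C : ℝ} (hC : 0 ≤ C)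
    (hTC : ∀ x, ‖T.op x h - h‖ ≤ C * ‖𝒢.coord x.log‖) (R : ℝ) : ∃ K, 0 ≤ K ∧ ∀ r : PosReal,
    (r : ℝ) ≤ R → ∀ x, ‖T.op (𝒢.dilation r x) h - h‖ ≤ K * r * ‖𝒢.coord x.log‖ := by
  obtain ⟨K, hK, hKb⟩ := 𝒢.exists_dil_bound R
  refine ⟨C * K, mul_nonneg hC hK, fun r hr x => ?_⟩
  refine (hTC _).trans ?_
  have := mul_le_mul_of_nonneg_left (hKb r hr x.log) hC
  refine this.trans (le_of_eq ?_)
  ring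

theorem lintegral_norm_sub_lt_top [FiniteDimensional ℝ L] {h : H} {C : ℝ} (hC : 0 ≤ C)
    (hTC : ∀ x, ‖T.op x h - h‖ ≤ C * ‖𝒢.coord x.log‖) {m : Measure PosReal}
    (hm : UnitaryRep.IsAdmissible m) (hle : m ≤ PosReal.haar) (x : 𝒢.N) :
    ∫⁻ r, ‖T.op (𝒢.dilation r x) h - h‖ₑ ∂m < ⊤ := by
  have huniv : (Set.univ : Set PosReal) = {r : PosReal | (r : ℝ) ≤ 1} ∪ Set.Ici 1 := by
    ext r
    exact ⟨fun _ => le_total (r : ℝ) 1, fun _ => trivial⟩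
  rw [← setLIntegral_univ, huniv]
  refine (lintegral_union_le _ _ _).trans_lt (ENNReal.add_lt_top.2 ⟨?_, ?_⟩)
  · obtain ⟨K, hK, hKb⟩ := exists_dilation_bound hC hTC 1
    have h1 : ∀ r ∈ {r : PosReal | (r : ℝ) ≤ 1}, ‖T.op (𝒢.dilation r x) h - h‖ₑ ≤
        ENNReal.ofReal (K * ‖𝒢.coord x.log‖) * ENNReal.ofReal ((r : ℝ) ^ (0 + 1)) := by
      intro r hr
      rw [← ENNReal.ofReal_mul (by positivity), ← ofReal_norm]
      refine ENNReal.ofReal_le_ofReal ((hKb r hr x).trans (le_of_eq ?_))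
      ring
    have hs : MeasurableSet {r : PosReal | (r : ℝ) ≤ 1} :=
      measurableSet_le measurable_subtype_coe measurable_const
    refine (setLIntegral_mono' hs h1).trans_lt ?_
    refine (lintegral_mono' (Measure.restrict_mono le_rfl hle) le_rfl).trans_lt ?_
    rw [lintegral_const_mul' _ _ ENNReal.ofReal_ne_top]
    exact ENNReal.mul_lt_top ENNReal.ofReal_lt_top (PosReal.lintegral_Iic_pow_lt_top 1 0)
  · refine (lintegral_mono (g := fun _ => ENNReal.ofReal (2 * ‖h‖)) fun r => ?_).trans_lt ?_
    · rw [← ofReal_norm]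
      exact ENNReal.ofReal_le_ofReal (T.norm_op_sub_le _ h)
    · rw [setLIntegral_const]
      exact ENNReal.mul_lt_top ENNReal.ofReal_lt_top (hm.2 1)

/-- A unitary representation of `N` without invariant vectors is summable with respect to every
admissible measure dominated by the Haar measure. -/
theorem isSummable [FiniteDimensional ℝ L] [CompleteSpace H] [Nontrivial H]
    (hT : T.NoInvariantVectors) {m : Measure PosReal} (hm : UnitaryRep.IsAdmissible m)
    (hle : m ≤ PosReal.haar) : T.IsSummable 𝒢.dilation m := by
  obtain ⟨h, h0, C, hC, hTC⟩ := 𝒢.exists_lipschitz_vector T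
  exact ⟨hm, fun r v hv => hT.comp_mulEquiv _ hv, h, h0,
    fun x => lintegral_norm_sub_lt_top hC hTC hm hle x⟩

/-! ### The nontrivial cocycle -/

/-- A Lipschitz cut-off function: `1` for `r ≤ 1` and `0` for `r ≥ 2`. -/
noncomputable def cutoff (r : ℝ) : ℝ := max 0 (min 1 (2 - r))

theorem cutoff_of_le_one {r : ℝ} (hr : r ≤ 1) : cutoff r = 1 := by
  rw [cutoff, min_eq_left (by linarith), max_eq_right zero_le_one]

theorem cutoff_of_two_le {r : ℝ} (hr : 2 ≤ r) : cutoff r = 0 :=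
  max_eq_left ((min_le_right _ _).trans (by linarith))

theorem continuous_cutoff : Continuous cutoff :=
  continuous_const.max (continuous_const.min (continuous_const.sub continuous_id))

theorem abs_cutoff_le_one (r : ℝ) : |cutoff r| ≤ 1 := by
  rw [abs_of_nonneg (le_max_left _ _)]
  exact max_le zero_le_one (min_le_left _ _)

theorem abs_cutoff_sub_le (r s : ℝ) : |cutoff r - cutoff s| ≤ |r - s| := by
  rw [cutoff, cutoff, max_comm 0, max_comm 0]
  refine (abs_max_sub_max_le_abs _ _ _).trans ?_
  rw [min_comm 1, min_comm 1]
  refine (abs_min_sub_min_le_max _ _ _ _).trans ?_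
  rw [sub_self, abs_zero, max_eq_left (abs_nonneg _), sub_sub_sub_cancel_left, abs_sub_comm]

/-- The formal coboundary of the function `r ↦ cutoff r • h`, which is not square integrable. -/
noncomputable def cobdry (T : UnitaryRep 𝒢.N H) (h : H) (g : 𝒢.N ⋊[𝒢.dilation] PosReal)
    (r : PosReal) : H :=
  (cutoff (r * g.right) : ℂ) • T.op (𝒢.dilation r g.left) h - (cutoff r : ℂ) • h

theorem cobdry_one (h : H) (r : PosReal) : cobdry T h 1 r = 0 := by
  simp [cobdry]

/-- The cocycle identity holds pointwise. -/
theorem cobdry_mul (h : H) (g₁ g₂ : 𝒢.N ⋊[𝒢.dilation] PosReal) (r : PosReal) :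
    cobdry T h (g₁ * g₂) r =
      T.op (𝒢.dilation r g₁.left) (cobdry T h g₂ (r * g₁.right)) + cobdry T h g₁ r := by
  simp only [cobdry, SemidirectProduct.mul_left, SemidirectProduct.mul_right, map_mul, map_sub,
    map_smul, Positive.val_mul, mul_assoc]
  simp

theorem continuous_cobdry [FiniteDimensional ℝ L] (h : H) (g : 𝒢.N ⋊[𝒢.dilation] PosReal) :
    Continuous (cobdry T h g) := by
  have h1 : Continuous fun r : PosReal => 𝒢.dilation r g.left :=
    𝒢.continuous_dilation.comp (continuous_id.prodMk continuous_const)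
  have h2 : Continuous fun r : PosReal => cutoff (r * g.right) :=
    continuous_cutoff.comp (continuous_subtype_val.mul continuous_const)
  have h3 : Continuous fun r : PosReal => cutoff r := continuous_cutoff.comp continuous_subtype_val
  exact ((Complex.continuous_ofReal.comp h2).smul ((T.continuous_op h).comp h1)).sub
    ((Complex.continuous_ofReal.comp h3).smul continuous_const)

/-- For dilation parameters bounded below, formal coboundaries differ by a small multiple of one
square integrable function. This gives both their square integrability and their continuity. -/
theorem exists_cobdry_sub_bound [FiniteDimensional ℝ L] {h : H} {C : ℝ} (hC : 0 ≤ C)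
    (hTC : ∀ x, ‖T.op x h - h‖ ≤ C * ‖𝒢.coord x.log‖) {σ : ℝ} (hσ : 0 < σ) :
    ∃ K, ∀ g g₀ : 𝒢.N ⋊[𝒢.dilation] PosReal, σ ≤ g.right → σ ≤ g₀.right → ∀ r,
      ‖cobdry T h g r - cobdry T h g₀ r‖ ≤ (|(g.right : ℝ) - g₀.right| * ‖h‖ +
        K * ‖𝒢.coord (g₀.left⁻¹ * g.left).log‖) * ‖PosReal.trunc (2 / σ) r‖ := by
  obtain ⟨K, hK, hKb⟩ := exists_dilation_bound hC hTC (2 / σ)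
  refine ⟨K, fun g g₀ hg hg₀ r => ?_⟩
  have hr : (0 : ℝ) < r := r.2
  rw [cobdry, cobdry, sub_sub_sub_cancel_right]
  by_cases hrR : (r : ℝ) ≤ 2 / σ
  · rw [PosReal.trunc, if_pos hrR, Real.norm_of_nonneg hr.le]
    set A := T.op (𝒢.dilation r g.left)
    set A₀ := T.op (𝒢.dilation r g₀.left)
    have h1 : (cutoff (r * g.right) : ℂ) • A h - (cutoff (r * g₀.right) : ℂ) • A₀ h =
        ((cutoff (r * g.right) - cutoff (r * g₀.right) : ℝ) : ℂ) • A h +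
          (cutoff (r * g₀.right) : ℂ) • (A h - A₀ h) := by
      rw [Complex.ofReal_sub, sub_smul, smul_sub]
      abel
    have h2 : ‖A h - A₀ h‖ ≤ K * r * ‖𝒢.coord (g₀.left⁻¹ * g.left).log‖ := by
      refine le_trans (le_of_eq ?_) (hKb r hrR (g₀.left⁻¹ * g.left))
      have h3 : A h = A₀ (T.op (𝒢.dilation r (g₀.left⁻¹ * g.left)) h) := by
        have h4 := congrArg (fun x => T.op (𝒢.dilation r x) h) (mul_inv_cancel_left g₀.left g.left)
        simp only [map_mul (𝒢.dilation r) g₀.left, map_mul T.op (𝒢.dilation r g₀.left)] at h4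
        exact h4.symm
      rw [h3, ← map_sub, LinearIsometryEquiv.norm_map]
    rw [h1]
    refine (norm_add_le _ _).trans ?_
    rw [norm_smul, norm_smul, Complex.norm_real, Complex.norm_real, Real.norm_eq_abs,
      Real.norm_eq_abs, LinearIsometryEquiv.norm_map, add_mul]
    refine add_le_add ?_ ?_
    · refine (mul_le_mul_of_nonneg_right (abs_cutoff_sub_le _ _) (norm_nonneg h)).trans
        (le_of_eq ?_)
      rw [← mul_sub, abs_mul, abs_of_pos hr]
      ring
    · refine (mul_le_of_le_one_left (norm_nonneg _) (abs_cutoff_le_one _)).trans (h2.trans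
        (le_of_eq ?_))
      ring
  · have h1 : ∀ s : ℝ, σ ≤ s → cutoff (r * s) = 0 := by
      intro s hs
      refine cutoff_of_two_le ?_
      have h2 : 2 < r * σ := by rwa [not_le, div_lt_iff₀ hσ] at hrR
      nlinarith
    rw [h1 _ hg, h1 _ hg₀, PosReal.trunc, if_neg hrR]
    simp

theorem memLp_cobdry [FiniteDimensional ℝ L] {h : H} {C : ℝ} (hC : 0 ≤ C)
    (hTC : ∀ x, ‖T.op x h - h‖ ≤ C * ‖𝒢.coord x.log‖) (g : 𝒢.N ⋊[𝒢.dilation] PosReal) :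
    MemLp (cobdry T h g) 2 PosReal.haar := by
  have hσ : (0 : ℝ) < min g.right 1 := lt_min g.right.2 zero_lt_one
  obtain ⟨K, hK⟩ := exists_cobdry_sub_bound hC hTC hσ
  refine (PosReal.memLp_trunc (2 / min g.right 1)).of_le_mul
    (c := |(g.right : ℝ) - (1 : PosReal)| * ‖h‖ + K * ‖𝒢.coord ((1 : 𝒢.N)⁻¹ * g.left).log‖)
    (continuous_cobdry h g).aestronglyMeasurable (.of_forall fun r => ?_)
  have := hK g 1 (min_le_left g.right 1) (min_le_right g.right 1) r
  rwa [cobdry_one, sub_zero] at this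

/-- The formal coboundary of `r ↦ cutoff r • h`, for a Lipschitz vector `h`, is a nontrivial
cocycle. -/
theorem isSpecial_tilde [FiniteDimensional ℝ L] [CompleteSpace H] [Nontrivial H]
    (hT : T.NoInvariantVectors) : (𝒢.tilde T).IsSpecial := by
  obtain ⟨h, h0, C, hC, hTC⟩ := 𝒢.exists_lipschitz_vector T
  have htilde : ∀ g (f : Lp H 2 PosReal.haar), (𝒢.tilde T).op g f =ᵐ[PosReal.haar]
      fun r => T.op (𝒢.dilation r g.left) (f (r * g.right)) :=
    T.coeFn_tildeFun 𝒢.continuous_dilation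
  set β : 𝒢.N ⋊[𝒢.dilation] PosReal → Lp H 2 PosReal.haar := fun g =>
    (memLp_cobdry hC hTC g).toLp (cobdry T h g) with hβ
  have hβe : ∀ g, β g =ᵐ[PosReal.haar] cobdry T h g := fun g => MemLp.coeFn_toLp _
  have hproj : Continuous fun g : 𝒢.N ⋊[𝒢.dilation] PosReal => (g.left, g.right) :=
    continuous_induced_dom
  refine ⟨β, ⟨?_, fun g₁ g₂ => ?_⟩, ?_⟩
  · rw [continuous_iff_continuousAt]
    intro g₀
    have hσ : (0 : ℝ) < (g₀.right : ℝ) / 2 := half_pos g₀.right.2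
    obtain ⟨K, hK⟩ := exists_cobdry_sub_bound hC hTC hσ
    set τ := (PosReal.memLp_trunc (2 / ((g₀.right : ℝ) / 2))).toLp _ with hτ
    have hr : Continuous fun g : 𝒢.N ⋊[𝒢.dilation] PosReal => (g.right : ℝ) :=
      continuous_subtype_val.comp (continuous_snd.comp hproj)
    have hl : Continuous fun g : 𝒢.N ⋊[𝒢.dilation] PosReal =>
        ‖𝒢.coord (g₀.left⁻¹ * g.left).log‖ :=
      𝒢.continuous_norm_coord_log.comp ((𝒢.continuous_mul_left _).comp (continuous_fst.comp hproj))
    have hb : ∀ᶠ g in nhds g₀, ‖β g - β g₀‖ ≤ (|(g.right : ℝ) - g₀.right| * ‖h‖ +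
        K * ‖𝒢.coord (g₀.left⁻¹ * g.left).log‖) * ‖τ‖ := by
      have h1 : ∀ᶠ g : 𝒢.N ⋊[𝒢.dilation] PosReal in nhds g₀, (g₀.right : ℝ) / 2 < g.right :=
        hr.continuousAt.eventually (lt_mem_nhds (half_lt_self g₀.right.2))
      filter_upwards [h1] with g hg
      refine Lp.norm_le_mul_norm_of_ae_le_mul ?_
      filter_upwards [Lp.coeFn_sub (β g) (β g₀), hβe g, hβe g₀,
        MemLp.coeFn_toLp (PosReal.memLp_trunc (2 / ((g₀.right : ℝ) / 2)))] with r h2 h3 h4 h5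
      rw [h2, Pi.sub_apply, h3, h4, hτ, h5]
      exact hK g g₀ hg.le (half_le_self g₀.right.2.le) r
    have hlim : Filter.Tendsto (fun g : 𝒢.N ⋊[𝒢.dilation] PosReal =>
        (|(g.right : ℝ) - g₀.right| * ‖h‖ + K * ‖𝒢.coord (g₀.left⁻¹ * g.left).log‖) * ‖τ‖)
        (nhds g₀) (nhds 0) := by
      have h1 : Continuous fun g : 𝒢.N ⋊[𝒢.dilation] PosReal =>
          (|(g.right : ℝ) - g₀.right| * ‖h‖ + K * ‖𝒢.coord (g₀.left⁻¹ * g.left).log‖) * ‖τ‖ :=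
        (((hr.sub continuous_const).abs.mul continuous_const).add
          (continuous_const.mul hl)).mul continuous_const
      have h2 := h1.tendsto g₀
      have h3 : (1 : 𝒢.N).log = 0 := rfl
      rwa [sub_self, inv_mul_cancel, h3, map_zero, norm_zero, abs_zero, zero_mul, mul_zero,
        add_zero, zero_mul] at h2
    exact tendsto_iff_norm_sub_tendsto_zero.2
      (squeeze_zero' (.of_forall fun _ => norm_nonneg _) hb hlim)
  · refine Lp.ext ?_
    filter_upwards [hβe (g₁ * g₂), Lp.coeFn_add ((𝒢.tilde T).op g₁ (β g₂)) (β g₁), hβe g₁,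
      htilde g₁ (β g₂), UnitaryRep.ae_mul_right g₁.right (hβe g₂)] with r h1 h2 h3 h4 h5
    rw [h1, h2, Pi.add_apply, h3, h4, h5, cobdry_mul]
  · rintro ⟨f, hf⟩
    have h1 : ∀ x : 𝒢.N, ∀ᵐ r ∂PosReal.haar, T.op (𝒢.dilation r x) (f r - (cutoff r : ℂ) • h) =
        f r - (cutoff r : ℂ) • h := by
      intro x
      filter_upwards [hβe ⟨x, 1⟩, Lp.coeFn_sub ((𝒢.tilde T).op ⟨x, 1⟩ f) f,
        htilde ⟨x, 1⟩ f] with r h2 h3 h4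
      rw [hf, h3, Pi.sub_apply, h4, cobdry] at h2
      simp only [mul_one, Positive.val_one] at h2
      rw [map_sub, map_smul, sub_eq_sub_iff_sub_eq_sub, h2]
    -- A countable dense set of `x` makes the exceptional null set independent of `x`.
    obtain ⟨S, hS, hSd⟩ := TopologicalSpace.exists_countable_dense 𝒢.N
    have h2 : ∀ᵐ r ∂PosReal.haar, f r = (cutoff r : ℂ) • h := by
      filter_upwards [(ae_ball_iff hS).2 fun x _ => h1 x] with r hr
      refine sub_eq_zero.1 (hT.comp_mulEquiv (𝒢.dilation r) fun x => ?_)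
      have hδ : Continuous fun x : 𝒢.N => 𝒢.dilation r x :=
        𝒢.continuous_dilation.comp (continuous_const.prodMk continuous_id)
      have hclosed : IsClosed {x : 𝒢.N | T.op (𝒢.dilation r x) (f r - (cutoff r : ℂ) • h) =
          f r - (cutoff r : ℂ) • h} :=
        isClosed_eq ((T.continuous_op _).comp hδ) continuous_const
      exact hclosed.closure_subset_iff.2 hr (hSd x)
    -- `f = h` on `(0, 1]`, which has infinite measure.
    have h3 := (Lp.memLp f).meas_ge_lt_top two_ne_zero ENNReal.ofNat_ne_top
      (ε := ‖h‖₊) (by simpa using h0)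
    have h4 : PosReal.haar {r : PosReal | (r : ℝ) ≤ 1} ≤
        PosReal.haar {r | ‖h‖₊ ≤ ‖f r‖₊} := by
      refine measure_mono_ae ?_
      filter_upwards [h2] with r hr h5
      change ‖h‖₊ ≤ ‖f r‖₊
      rw [hr, cutoff_of_le_one h5, Complex.ofReal_one, one_smul]
    rw [PosReal.haar_Iic_one] at h4
    exact absurd h3 (not_lt.2 h4)

end LieGrading

/-! ### Irreducible unitary representations -/

namespace UnitaryRep

variable {G : Type*} [Group G] [TopologicalSpace G]
  {H : Type*} [NormedAddCommGroup H] [InnerProductSpace ℂ H] {T : UnitaryRep G H}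

/-- The orbit of a nonzero vector under an irreducible representation is total. -/
theorem IsIrreducible.eq_zero_or_eq_zero (hT : T.IsIrreducible) {u v : H}
    (h : ∀ x, inner ℂ u (T.op x v) = 0) : v = 0 ∨ u = 0 := by
  let W : Submodule ℂ H :=
    { carrier := {w | ∀ x, inner ℂ u (T.op x w) = 0}
      add_mem' := fun {a b} ha hb x => by rw [map_add, inner_add_right, ha, hb, add_zero]
      zero_mem' := fun x => by rw [map_zero, inner_zero_right]
      smul_mem' := fun c a ha x => by rw [map_smul, inner_smul_right, ha, mul_zero] }
  have hW : IsClosed (W : Set H) := by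
    have : (W : Set H) = ⋂ x, {w | inner ℂ u (T.op x w) = 0} := by
      ext w
      simp [W]
    rw [this]
    exact isClosed_iInter fun x =>
      isClosed_eq (continuous_const.inner (T.op x).continuous) continuous_const
  have hWinv : ∀ g, ∀ w ∈ W, T.op g w ∈ W := fun g w hw x => by
    have := hw (x * g)
    rwa [map_mul] at this
  rcases hT.2 W hW hWinv with hW' | hW'
  · exact .inl ((Submodule.mem_bot ℂ).1 (hW' ▸ (h : v ∈ W)))
  · have hu : u ∈ W := hW' ▸ Submodule.mem_top
    have := hu 1
    rw [map_one] at this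
    exact .inr (inner_self_eq_zero.1 this)

/-- Schur's lemma. If a normal operator commuting with `T` had two points in its spectrum, then two
continuous functions of it with product zero, both nonzero, would yield a proper closed invariant
subspace. -/
theorem IsIrreducible.exists_eq_smul [CompleteSpace H] (hT : T.IsIrreducible) (U : H ≃ₗᵢ[ℂ] H)
    (hU : ∀ g v, U (T.op g v) = T.op g (U v)) : ∃ c : ℂ, ∀ v, U v = c • v := by
  have hnt : Nontrivial H := hT.1
  let toL : (H ≃ₗᵢ[ℂ] H) → (H →L[ℂ] H) := fun V => ((V : H ≃L[ℂ] H) : H →L[ℂ] H)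
  set a : H →L[ℂ] H := toL U with ha
  have hstar : star a = toL U.symm := by
    rw [ContinuousLinearMap.star_eq_adjoint]
    exact LinearIsometryEquiv.adjoint_eq_symm U
  have : IsStarNormal a := by
    refine ⟨?_⟩
    rw [hstar]
    ext v
    simp [ha, toL]
  have hcomm : ∀ (f : ℂ → ℂ) g, Commute (cfc f a) (toL (T.op g)) := by
    intro f g
    refine Commute.cfc ?_ ?_ f
    · ext v
      exact hU g v
    · rw [hstar]
      ext v
      change U.symm (T.op g v) = T.op g (U.symm v)
      rw [LinearIsometryEquiv.symm_apply_eq, hU, LinearIsometryEquiv.apply_symm_apply]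
  obtain ⟨c, hc⟩ : (spectrum ℂ a).Nonempty := spectrum.nonempty a
  have hspec : ∀ d ∈ spectrum ℂ a, d = c := by
    intro d hd
    by_contra hdc
    set δ := ‖d - c‖ / 2 with hδ
    have hδpos : 0 < δ := half_pos (norm_pos_iff.2 (sub_ne_zero.2 hdc))
    let F : ℂ → ℂ → ℂ := fun p z => ((max 0 (δ - ‖z - p‖) : ℝ) : ℂ)
    have hFc : ∀ p, Continuous (F p) := fun p => Complex.continuous_ofReal.comp
      (continuous_const.max (continuous_const.sub (continuous_id.sub continuous_const).norm))
    have hFne : ∀ p ∈ spectrum ℂ a, cfc (F p) a ≠ 0 := by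
      intro p hp h0
      have h1 : F p p ∈ spectrum ℂ (cfc (F p) a) := by
        rw [cfc_map_spectrum (F p) a (hf := (hFc p).continuousOn)]
        exact ⟨p, hp, rfl⟩
      rw [h0, spectrum.zero_eq, Set.mem_singleton_iff] at h1
      simp only [F, sub_self, norm_zero, sub_zero, Complex.ofReal_eq_zero] at h1
      rw [max_eq_right hδpos.le] at h1
      exact hδpos.ne' h1
    have hmul : cfc (F c) a * cfc (F d) a = 0 := by
      rw [← cfc_mul (F c) (F d) a (hFc c).continuousOn (hFc d).continuousOn,
        ← cfc_const_zero ℂ a]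
      refine cfc_congr fun z _ => ?_
      have h1 : ‖d - c‖ ≤ ‖z - c‖ + ‖z - d‖ := by
        rw [show d - c = (z - c) - (z - d) by ring]
        exact norm_sub_le _ _
      rcases le_total δ ‖z - c‖ with h2 | h2
      · simp [F, max_eq_left (sub_nonpos.2 h2)]
      · have h3 : δ ≤ ‖z - d‖ := by linarith
        simp [F, max_eq_left (sub_nonpos.2 h3)]
    have hinv : ∀ g, ∀ v ∈ (cfc (F c) a).ker, T.op g v ∈ (cfc (F c) a).ker := by
      intro g v hv
      have h1 := congrArg (fun S : H →L[ℂ] H => S v) (hcomm (F c) g).eq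
      have h2 : cfc (F c) a v = 0 := hv
      change cfc (F c) a (T.op g v) = T.op g (cfc (F c) a v) at h1
      rw [h2, map_zero] at h1
      exact h1
    rcases hT.2 (cfc (F c) a).ker (cfc (F c) a).isClosed_ker hinv with hW | hW
    · refine hFne d hd (ContinuousLinearMap.ext fun v => ?_)
      have h1 : cfc (F d) a v ∈ (cfc (F c) a).ker := by
        rw [LinearMap.mem_ker]
        exact congrArg (fun S : H →L[ℂ] H => S v) hmul
      rwa [hW, Submodule.mem_bot] at h1
    · refine hFne c hc (ContinuousLinearMap.ext fun v => ?_)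
      have h1 : v ∈ (cfc (F c) a).ker := hW ▸ Submodule.mem_top
      exact LinearMap.mem_ker.1 h1
  refine ⟨c, fun v => ?_⟩
  have h1 : a = algebraMap ℂ (H →L[ℂ] H) c := by
    calc a = cfc (fun z : ℂ => z) a := (cfc_id' ℂ a).symm
      _ = cfc (fun _ : ℂ => c) a := cfc_congr fun z hz => hspec z hz
      _ = _ := cfc_const c a
  have h2 := congrArg (fun S : H →L[ℂ] H => S v) h1
  rw [Algebra.algebraMap_eq_smul_one] at h2
  exact h2

end UnitaryRep

/-! ### The scalar action of the last nontrivial layer -/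

namespace LieGrading

variable {L : Type*} [LieRing L] [LieAlgebra ℝ L] (𝒢 : LieGrading L)

theorem continuous_mk_smul (z : L) : Continuous fun t : ℝ => (⟨t • z⟩ : 𝒢.N) := by
  let _ : TopologicalSpace L := moduleTopology ℝ L
  have : IsModuleTopology ℝ L := ⟨rfl⟩
  have : ContinuousSMul ℝ L := IsModuleTopology.toContinuousSMul ℝ L
  exact 𝒢.continuous_N_iff.2 (continuous_id.smul continuous_const)

variable [LieRing.IsNilpotent L]

/-- The degree filtration of `L` can be read off from the action on `D`, since `D` acts on `R_i` by
the scalar `i`, which is nonzero for `i ≥ 1`. -/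
theorem mem_tail_of_expAd_elD {k : ℕ} {x : L} (h : 𝒢.expAd x 𝒢.elD - 𝒢.elD ∈ 𝒢.tailE k) :
    x ∈ 𝒢.tail k := by
  cases k with
  | zero => exact 𝒢.tail_anti zero_le_one (𝒢.mem_tail_one x)
  | succ k =>
    have key : ∀ j ≤ k, x ∈ 𝒢.tail (j + 1) := by
      intro j
      induction j with
      | zero => exact fun _ => 𝒢.mem_tail_one x
      | succ j ih =>
        intro hj
        have h1 := 𝒢.expAd_add_sub 0 (ih (by omega)) 𝒢.elD
        rw [zero_add, expAd_zero, Module.End.one_apply] at h1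
        have h2 := (𝒢.tailE (j + 1 + 1)).sub_mem (𝒢.tailE_anti (by omega) h) h1
        rw [sub_sub_cancel, adE_apply] at h2
        have h3 : ⁅x, (0 : L)⁆ - (1 : ℝ) • 𝒢.D x ∈ 𝒢.tail (j + 1 + 1) := h2.1
        rw [lie_zero, one_smul, zero_sub, neg_mem_iff, mem_tail] at h3
        rw [mem_tail]
        intro i hi
        have h4 := h3 i hi
        rw [D_apply, proj_scale, smul_eq_zero] at h4
        rcases h4 with h4 | h4
        · obtain rfl : i = 0 := by exact_mod_cast h4
          exact 𝒢.proj_zero _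
        · exact h4
    exact key k le_rfl

theorem expAd_sub_self_mem_add {i k : ℕ} {a : L} (ha : a ∈ 𝒢.tail i) {x : 𝒢.Ext}
    (hx : x ∈ 𝒢.tailE k) : 𝒢.expAd a x - x ∈ 𝒢.tailE (i + k) := by
  refine 𝒢.expAd_sub_self_mem_of a _ x fun j => ?_
  induction j with
  | zero => simpa using 𝒢.adE_tail ha hx
  | succ j ih =>
    rw [pow_succ']
    exact 𝒢.tailE_anti (by omega) (𝒢.adE_tail ha ih)

theorem expAd_sub_self_mem_tailE {i : ℕ} {a : L} (ha : a ∈ 𝒢.tail i) (x : 𝒢.Ext) :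
    𝒢.expAd a x - x ∈ 𝒢.tailE i := by
  refine 𝒢.expAd_sub_self_mem_of a _ x fun j => ?_
  induction j with
  | zero => simpa using 𝒢.adE_mem ha x
  | succ j ih =>
    rw [pow_succ']
    exact 𝒢.tailE_anti (by omega) (𝒢.adE_tail ha ih)

/-- The filtration of `N` by the subsets `exp (tail k)` is central. -/
theorem log_commutator_mem_tail {k : ℕ} (n : 𝒢.N) {x : 𝒢.N} (hx : x.log ∈ 𝒢.tail k) :
    (n * x * (x * n)⁻¹).log ∈ 𝒢.tail (k + 1) := by
  have h1 : ∀ y : 𝒢.Ext, 𝒢.expAd (n * x).log y - 𝒢.expAd (x * n).log y ∈ 𝒢.tailE (k + 1) := by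
    intro y
    have h2 := 𝒢.expAd_sub_self_mem n.log (𝒢.expAd_sub_self_mem_tailE hx y)
    have h3 := 𝒢.expAd_sub_self_mem_add hx
      (𝒢.expAd_sub_self_mem_tailE (𝒢.mem_tail_one n.log) y)
    have h4 := (𝒢.tailE _).sub_mem h2 h3
    -- `AB - BA = (A - 1)(B - 1) - (B - 1)(A - 1)`
    rw [expAd_mul, expAd_mul, Module.End.mul_apply, Module.End.mul_apply]
    convert! h4 using 1
    simp only [map_sub]
    abel
  refine 𝒢.mem_tail_of_expAd_elD ?_
  rw [expAd_mul, Module.End.mul_apply]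
  have h5 := h1 (𝒢.expAd (x * n)⁻¹.log 𝒢.elD)
  rwa [← Module.End.mul_apply (𝒢.expAd (x * n).log), ← expAd_mul, mul_inv_cancel,
    show (1 : 𝒢.N).log = 0 from rfl, expAd_zero, Module.End.one_apply] at h5

/-- Modulo elements of higher degree, an element of `exp (tail k)` is determined by its component
in `R_k`. -/
theorem log_proj_inv_mul_mem_tail {k : ℕ} {x : L} (hx : x ∈ 𝒢.tail k) :
    ((⟨𝒢.proj k x⟩ : 𝒢.N)⁻¹ * ⟨x⟩).log ∈ 𝒢.tail (k + 1) := by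
  have hb : x - 𝒢.proj k x ∈ 𝒢.tail (k + 1) := by
    rw [mem_tail]
    intro j hj
    rw [map_sub, 𝒢.proj_of_mem (𝒢.proj_mem k x)]
    split_ifs with hjk
    · rw [hjk, sub_self]
    · rw [sub_zero]
      exact 𝒢.mem_tail.1 hx j (by omega)
  have h1 := 𝒢.expAd_add_sub (𝒢.proj k x) hb 𝒢.elD
  rw [add_sub_cancel] at h1
  have h2 := (𝒢.tailE (k + 1)).add_mem (𝒢.tailE_anti (by omega) h1) (𝒢.adE_mem hb 𝒢.elD)
  rw [sub_add_cancel] at h2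
  have h3 := (𝒢.tailE (k + 1)).add_mem
    (𝒢.tailE_anti (by omega) (𝒢.expAd_sub_self_mem (-𝒢.proj k x) h2)) h2
  refine 𝒢.mem_tail_of_expAd_elD ?_
  rw [expAd_mul, Module.End.mul_apply]
  change 𝒢.expAd (-𝒢.proj k x) (𝒢.expAd x 𝒢.elD) - 𝒢.elD ∈ _
  rw [sub_add_cancel, map_sub, ← Module.End.mul_apply _ (𝒢.expAd (𝒢.proj k x)), expAd_neg_mul,
    Module.End.one_apply] at h3
  exact h3

theorem mk_add_smul (s t : ℝ) (z : L) :
    (⟨(s + t) • z⟩ : 𝒢.N) = ⟨s • z⟩ * ⟨t • z⟩ := by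
  refine N.ext (𝒢.expAd_injective ?_)
  have hcomm : Commute (𝒢.adE (s • z)) (𝒢.adE (t • z)) := by
    rw [map_smul, map_smul]
    exact ((Commute.refl _).smul_left s).smul_right t
  rw [expAd_mul]
  change 𝒢.expAd ((s + t) • z) = 𝒢.expAd (s • z) * 𝒢.expAd (t • z)
  rw [expAd, add_smul, map_add,
    IsNilpotent.exp_add_of_commute hcomm (𝒢.adE_nilpotent _) (𝒢.adE_nilpotent _)]
  rfl

theorem dilation_mk_smul {k : ℕ} {z : L} (hz : z ∈ 𝒢.R k) (r : PosReal) (t : ℝ) :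
    𝒢.dilation r ⟨t • z⟩ = ⟨(t * (r : ℝ) ^ k) • z⟩ := by
  refine N.ext ?_
  change 𝒢.dil r (t • z) = _
  rw [dil, map_smul, 𝒢.scale_of_mem _ hz, smul_smul]

variable {𝒢} {H : Type*} [NormedAddCommGroup H] [InnerProductSpace ℂ H] {T : UnitaryRep 𝒢.N H}

/-- A nontrivial irreducible representation acts by a nontrivial character on a homogeneous
one-parameter subgroup, namely one in the last layer of the grading on which it is nontrivial:
that layer is central modulo the kernel. -/
theorem exists_character [CompleteSpace H] (hT : T.IsIrreducible) (hinv : T.NoInvariantVectors) :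
    ∃ k, k ≠ 0 ∧ ∃ z ∈ 𝒢.R k, ∃ χ : AddChar ℝ Circle, Continuous χ ∧ χ ≠ 1 ∧
      ∀ t v, T.op ⟨t • z⟩ v = (χ t : ℂ) • v := by
  have hnt : Nontrivial H := hT.1
  obtain ⟨v₀, hv₀⟩ := exists_ne (0 : H)
  let P : ℕ → Prop := fun k => ∀ x : 𝒢.N, x.log ∈ 𝒢.tail k → T.op x = 1
  have hP1 : ¬ P 1 := fun h =>
    hv₀ (hinv v₀ fun x => by rw [h x (𝒢.mem_tail_one _)]; rfl)
  have hPtop : P (𝒢.cls + 1) := by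
    intro x hx
    have h1 : x = 1 := N.ext (𝒢.eq_zero_of_mem_tail (Nat.lt_succ_self _) hx)
    rw [h1, map_one]
  obtain ⟨k, hk, hPk, hPk1⟩ : ∃ k, k ≠ 0 ∧ ¬ P k ∧ P (k + 1) := by
    by_contra! hcon
    have h1 : ∀ j, ¬ P (j + 1) := by
      intro j
      induction j with
      | zero => exact hP1
      | succ j ih => exact hcon _ (Nat.succ_ne_zero j) ih
    exact h1 _ hPtop
  obtain ⟨x, hx, hTx⟩ : ∃ x : 𝒢.N, x.log ∈ 𝒢.tail k ∧ T.op x ≠ 1 := by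
    simpa [P] using hPk
  set z := 𝒢.proj k x.log with hz
  have hzR : z ∈ 𝒢.R k := 𝒢.proj_mem k _
  have hTz : T.op ⟨z⟩ ≠ 1 := by
    have h1 := hPk1 _ (𝒢.log_proj_inv_mul_mem_tail hx)
    rw [map_mul, map_inv, inv_mul_eq_one] at h1
    rw [hz, h1]
    exact hTx
  have hscalar : ∀ t : ℝ, ∃ c : ℂ, ∀ v, T.op ⟨t • z⟩ v = c • v := by
    intro t
    refine hT.exists_eq_smul _ fun g v => ?_
    have ht : (⟨t • z⟩ : 𝒢.N).log ∈ 𝒢.tail k := by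
      rw [mem_tail]
      intro j hj
      change 𝒢.proj j (t • z) = 0
      rw [map_smul, 𝒢.proj_of_mem hzR, if_neg hj.ne, smul_zero]
    have h1 := hPk1 _ (𝒢.log_commutator_mem_tail g ht)
    rw [map_mul, map_inv, mul_inv_eq_one, map_mul, map_mul] at h1
    exact (congrArg (fun S : H ≃ₗᵢ[ℂ] H => S v) h1).symm
  choose c hc using hscalar
  have hcn : ∀ t, ‖c t‖ = 1 := by
    intro t
    have h1 := (T.op ⟨t • z⟩).norm_map v₀
    rw [hc, norm_smul] at h1
    exact mul_right_cancel₀ (norm_ne_zero_iff.2 hv₀) (h1.trans (one_mul _).symm)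
  have hcadd : ∀ s t, c (s + t) = c s * c t := by
    intro s t
    refine smul_left_injective ℂ hv₀ ?_
    change c (s + t) • v₀ = (c s * c t) • v₀
    rw [← hc, mk_add_smul, map_mul, mul_smul, ← hc t, ← hc s]
    rfl
  have hc0 : c 0 = 1 := by
    refine smul_left_injective ℂ hv₀ ?_
    change c 0 • v₀ = (1 : ℂ) • v₀
    rw [← hc, zero_smul, show (⟨0⟩ : 𝒢.N) = 1 from rfl, map_one, one_smul]
    rfl
  have hccont : Continuous c := by
    have h1 : ∀ t, c t = inner ℂ v₀ (T.op ⟨t • z⟩ v₀) / inner ℂ v₀ v₀ := by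
      intro t
      rw [hc, inner_smul_right, mul_div_cancel_right₀ _ (inner_self_ne_zero.2 hv₀)]
    simp only [funext h1]
    exact (continuous_const.inner
      ((T.continuous_op v₀).comp (𝒢.continuous_mk_smul z))).div_const _
  let χ : AddChar ℝ Circle :=
    { toFun := fun t => ⟨c t, mem_sphere_zero_iff_norm.2 (hcn t)⟩
      map_zero_eq_one' := Circle.ext hc0
      map_add_eq_mul' := fun s t => Circle.ext (hcadd s t) }
  refine ⟨k, hk, z, hzR, χ, hccont.subtype_mk _, fun h1 => hTz ?_, hc⟩
  ext v
  have h2 : c 1 = 1 := congrArg (fun ψ : AddChar ℝ Circle => (ψ 1 : ℂ)) h1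
  have h3 := hc 1 v
  rw [h2, one_smul, one_smul] at h3
  exact h3

end LieGrading

/-! ### Characters separate integrable functions -/

section Character

variable {α : Type*} {mα : MeasurableSpace α} {μ : Measure α} {φ : α → ℝ} {χ : AddChar ℝ Circle}

theorem integrable_char_mul (hχ : Continuous χ) (hφ : Measurable φ) (t : ℝ) {F : α → ℂ}
    (hF : Integrable F μ) : Integrable (fun a => (χ (t * φ a) : ℂ) * F a) μ := by
  have hm : Measurable fun a => (χ (t * φ a) : ℂ) :=
    (continuous_subtype_val.comp hχ).measurable.comp (hφ.const_mul t)
  refine hF.norm.mono' (hm.aestronglyMeasurable.mul hF.1) (.of_forall fun a => ?_)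
  rw [norm_mul, Circle.norm_coe, one_mul]

theorem ae_eq_zero_of_forall_integral_char_real (hχ : Continuous χ) (hχ1 : χ ≠ 1)
    (hφ : MeasurableEmbedding φ) {F : α → ℝ} (hF : Integrable F μ)
    (h : ∀ t, ∫ a, (χ (t * φ a) : ℂ) * (F a : ℂ) ∂μ = 0) : F =ᵐ[μ] 0 := by
  have hpos : ∀ {F : α → ℝ}, Integrable F μ →
      IsFiniteMeasure (μ.withDensity fun a => ENNReal.ofReal (F a)) := fun hF =>
    isFiniteMeasure_withDensity_ofReal hF.2
  have hfin₁ := hpos hF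
  have hfin₂ := hpos hF.neg
  have hL : Continuous fun p : ℝ × ℝ => LinearMap.mul ℝ ℝ p.1 p.2 := continuous_mul
  have hint : ∀ {F : α → ℝ}, Integrable F μ → ∀ t, ∫ v, BoundedContinuousFunction.char hχ hL t v
      ∂((μ.withDensity fun a => ENNReal.ofReal (F a)).map φ) =
      ∫ a, (χ (t * φ a) : ℂ) * ((max (F a) 0 : ℝ) : ℂ) ∂μ := by
    intro F hF t
    rw [hφ.integral_map,
      integral_withDensity_eq_integral_toReal_smul₀ hF.1.aemeasurable.ennreal_ofReal (.of_forall fun a => ENNReal.ofReal_lt_top)]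
    refine integral_congr_ae (.of_forall fun a => ?_)
    simp only [BoundedContinuousFunction.char_apply, LinearMap.mul_apply', ENNReal.toReal_ofReal']
    rw [Complex.real_smul, mul_comm (φ a), mul_comm ((max (F a) 0 : ℝ) : ℂ)]
  have hi : ∀ {F : α → ℝ}, Integrable F μ → ∀ t,
      Integrable (fun a => (χ (t * φ a) : ℂ) * ((max (F a) 0 : ℝ) : ℂ)) μ := fun hF t =>
    integrable_char_mul hχ hφ.measurable t hF.pos_part.ofReal
  -- The positive and negative parts of `F` have the same Fourier transform after transport by `φ`.
  have hmeas : (μ.withDensity fun a => ENNReal.ofReal (F a)).map φ =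
      (μ.withDensity fun a => ENNReal.ofReal ((-F) a)).map φ := by
    refine ext_of_integral_char_eq hχ hχ1 (fun v hv h0 => hv ?_) hL fun t => ?_
    · simpa using LinearMap.congr_fun h0 1
    · rw [hint hF, hint hF.neg, ← sub_eq_zero, ← integral_sub (hi hF t) (hi hF.neg t), ← h t]
      refine integral_congr_ae (.of_forall fun a => ?_)
      simp only [← mul_sub, ← Complex.ofReal_sub, Pi.neg_apply]
      rw [max_zero_sub_max_neg_zero_eq_self]
  have hd : (μ.withDensity fun a => ENNReal.ofReal (F a)) =
      μ.withDensity fun a => ENNReal.ofReal ((-F) a) := by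
    rw [← hφ.comap_map (μ.withDensity _), hmeas, hφ.comap_map]
  have hfin : ∫⁻ a, ENNReal.ofReal (F a) ∂μ ≠ ⊤ := hF.lintegral_lt_top.ne
  rw [withDensity_eq_iff hF.1.aemeasurable.ennreal_ofReal
    hF.neg.1.aemeasurable.ennreal_ofReal hfin] at hd
  filter_upwards [hd] with a ha
  rcases lt_trichotomy (F a) 0 with h0 | h0 | h0
  · rw [ENNReal.ofReal_of_nonpos h0.le, eq_comm, ENNReal.ofReal_eq_zero, Pi.neg_apply] at ha
    linarith
  · exact h0
  · rw [Pi.neg_apply, ENNReal.ofReal_of_nonpos (neg_nonpos.2 h0.le), ENNReal.ofReal_eq_zero] at ha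
    linarith

/-- Uniqueness of the Fourier transform of a complex density, for an arbitrary nontrivial continuous
character of `ℝ`. -/
theorem ae_eq_zero_of_forall_integral_char (hχ : Continuous χ) (hχ1 : χ ≠ 1)
    (hφ : MeasurableEmbedding φ) {F : α → ℂ} (hF : Integrable F μ)
    (h : ∀ t, ∫ a, (χ (t * φ a) : ℂ) * F a ∂μ = 0) : F =ᵐ[μ] 0 := by
  have hconj : Integrable (fun a => (starRingEnd ℂ) (F a)) μ :=
    (Complex.conjCLE : ℂ →L[ℝ] ℂ).integrable_comp hF
  have hc : ∀ t, ∫ a, (χ (t * φ a) : ℂ) * (starRingEnd ℂ) (F a) ∂μ = 0 := by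
    intro t
    have h1 := congrArg (starRingEnd ℂ) (h (-t))
    rw [← integral_conj, map_zero] at h1
    rw [← h1]
    refine integral_congr_ae (.of_forall fun a => ?_)
    simp only [map_mul]
    rw [neg_mul, AddChar.map_neg_eq_inv, Circle.coe_inv_eq_conj, Complex.conj_conj]
  -- `conj F` satisfies the same hypothesis, hence so do the real and imaginary parts of `F`.
  have hre : (fun a => (F a).re) =ᵐ[μ] 0 := by
    refine ae_eq_zero_of_forall_integral_char_real hχ hχ1 hφ hF.re fun t => ?_
    have h1 : ∀ a, (χ (t * φ a) : ℂ) * ((F a).re : ℂ) =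
        2⁻¹ * ((χ (t * φ a) : ℂ) * F a + (χ (t * φ a) : ℂ) * (starRingEnd ℂ) (F a)) := by
      intro a
      rw [Complex.re_eq_add_conj]
      ring
    simp only [h1]
    rw [integral_const_mul, integral_add (integrable_char_mul hχ hφ.measurable t hF)
      (integrable_char_mul hχ hφ.measurable t hconj), h, hc]
    simp
  have him : (fun a => (F a).im) =ᵐ[μ] 0 := by
    refine ae_eq_zero_of_forall_integral_char_real hχ hχ1 hφ hF.im fun t => ?_
    have h1 : ∀ a, (χ (t * φ a) : ℂ) * ((F a).im : ℂ) = (2 * Complex.I)⁻¹ *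
        ((χ (t * φ a) : ℂ) * F a - (χ (t * φ a) : ℂ) * (starRingEnd ℂ) (F a)) := by
      intro a
      rw [Complex.im_eq_sub_conj, div_eq_inv_mul]
      ring
    simp only [h1]
    rw [integral_const_mul, integral_sub (integrable_char_mul hχ hφ.measurable t hF)
      (integrable_char_mul hχ hφ.measurable t hconj), h, hc]
    simp
  filter_upwards [hre, him] with a h1 h2
  exact Complex.ext h1 h2

end Character

namespace PosReal

theorem measurableEmbedding_pow {k : ℕ} (hk : k ≠ 0) :
    MeasurableEmbedding fun r : PosReal => (r : ℝ) ^ k := by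
  have : StandardBorelSpace PosReal := (measurableSet_Ioi (a := (0 : ℝ))).standardBorel
  refine Measurable.measurableEmbedding (measurable_subtype_coe.pow_const k) fun r s h => ?_
  exact Subtype.ext ((pow_left_inj₀ r.2.le s.2.le hk).1 h)

/-- Ergodicity of the translations: two sets all of whose translates meet in null sets cannot both
have positive measure. -/
theorem haar_eq_zero_or {A B : Set PosReal} (hA : MeasurableSet A) (hB : MeasurableSet B)
    (h : ∀ s, ∀ᵐ r ∂haar, ¬ (r * s ∈ A ∧ r ∈ B)) : haar A = 0 ∨ haar B = 0 := by
  have hmul : Measurable fun p : PosReal × PosReal => p.2 * p.1 :=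
    Measurable.subtype_mk ((measurable_subtype_coe.comp measurable_snd).mul
      (measurable_subtype_coe.comp measurable_fst))
  have h1A : Measurable (A.indicator (1 : PosReal → ENNReal)) := measurable_one.indicator hA
  have h1B : Measurable (B.indicator (1 : PosReal → ENNReal)) := measurable_one.indicator hB
  have h0 : ∫⁻ s, ∫⁻ r, A.indicator 1 (r * s) * B.indicator (1 : PosReal → ENNReal) r
      ∂haar ∂haar = 0 := by
    have h1 : ∀ s, ∫⁻ r, A.indicator 1 (r * s) * B.indicator (1 : PosReal → ENNReal) r
        ∂haar = 0 := by
      intro s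
      rw [← lintegral_zero (μ := haar)]
      refine lintegral_congr_ae ?_
      filter_upwards [h s] with r hr
      by_cases hrA : r * s ∈ A
      · simp [show r ∉ B from fun hrB => hr ⟨hrA, hrB⟩]
      · simp [hrA]
    simp [h1]
  rw [lintegral_lintegral_swap ((h1A.comp hmul).mul (h1B.comp measurable_snd)).aemeasurable] at h0
  have h2 : ∀ r, ∫⁻ s, A.indicator 1 (r * s) * B.indicator (1 : PosReal → ENNReal) r ∂haar =
      haar A * B.indicator (1 : PosReal → ENNReal) r := by
    intro r
    have h3 : Measurable fun s : PosReal => A.indicator (1 : PosReal → ENNReal) (s * r) :=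
      h1A.comp (measurePreserving_mul_right r).measurable
    simp only [mul_comm r]
    rw [lintegral_mul_const _ h3, (measurePreserving_mul_right r).lintegral_comp h1A,
      lintegral_indicator_one hA]
  simp only [h2] at h0
  rw [lintegral_const_mul _ h1B, lintegral_indicator_one hB] at h0
  exact mul_eq_zero.1 h0

end PosReal

/-! ### Irreducibility -/

namespace LieGrading

variable {L : Type*} [LieRing L] [LieAlgebra ℝ L] [LieRing.IsNilpotent L] {𝒢 : LieGrading L}
  {H : Type*} [NormedAddCommGroup H] [InnerProductSpace ℂ H] {T : UnitaryRep 𝒢.N H}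

/-- Functions in an invariant subspace and in its orthogonal complement have, up to translation,
disjoint supports. -/
theorem ae_eq_zero_or_of_forall_inner_eq_zero [FiniteDimensional ℝ L] [CompleteSpace H]
    (hT : T.IsIrreducible) (hinv : T.NoInvariantVectors) {f g : Lp H 2 PosReal.haar}
    (h : ∀ x, inner ℂ g ((𝒢.tilde T).op x f) = 0) (s : PosReal) :
    ∀ᵐ r ∂PosReal.haar, f (r * s) = 0 ∨ g r = 0 := by
  obtain ⟨k, hk, z, hz, χ, hχ, hχ1, hTz⟩ := exists_character hT hinv
  have htilde : ∀ g (f : Lp H 2 PosReal.haar), (𝒢.tilde T).op g f =ᵐ[PosReal.haar]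
      fun r => T.op (𝒢.dilation r g.left) (f (r * g.right)) :=
    T.coeFn_tildeFun 𝒢.continuous_dilation
  have h1 : ∀ x : 𝒢.N, ∀ᵐ r ∂PosReal.haar,
      inner ℂ (g r) (T.op (𝒢.dilation r x) (f (r * s))) = 0 := by
    intro x
    set f' := (𝒢.tilde T).op ⟨x, s⟩ f with hf'
    have h2 : (fun r => inner ℂ (g r) (f' r)) =ᵐ[PosReal.haar] 0 := by
      refine ae_eq_zero_of_forall_integral_char hχ hχ1 (PosReal.measurableEmbedding_pow hk)
        (L2.integrable_inner g f') fun t => ?_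
      have h3 := h (⟨⟨t • z⟩, 1⟩ * ⟨x, s⟩)
      rw [map_mul, L2.inner_def] at h3
      rw [← h3]
      refine integral_congr_ae ?_
      filter_upwards [htilde ⟨⟨t • z⟩, 1⟩ f'] with r h4
      have h5 : ((𝒢.tilde T).op ⟨⟨t • z⟩, 1⟩ * (𝒢.tilde T).op ⟨x, s⟩) f =
          (𝒢.tilde T).op ⟨⟨t • z⟩, 1⟩ f' := rfl
      rw [h5, h4, mul_one, 𝒢.dilation_mk_smul hz, hTz, inner_smul_right]
    filter_upwards [h2, htilde ⟨x, s⟩ f] with r h3 h4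
    rw [← h4]
    exact h3
  obtain ⟨S, hS, hSd⟩ := TopologicalSpace.exists_countable_dense 𝒢.N
  filter_upwards [(ae_ball_iff hS).2 fun x _ => h1 x] with r hr
  refine hT.eq_zero_or_eq_zero fun x => ?_
  have hδ : Continuous fun x : 𝒢.N => 𝒢.dilation r x :=
    𝒢.continuous_dilation.comp (continuous_const.prodMk continuous_id)
  have hclosed : IsClosed {x : 𝒢.N | inner ℂ (g r) (T.op (𝒢.dilation r x) (f (r * s))) = 0} :=
    isClosed_eq (continuous_const.inner ((T.continuous_op _).comp hδ)) continuous_const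
  have h2 := hclosed.closure_subset_iff.2 hr (hSd ((𝒢.dilation r).symm x))
  simpa using h2

theorem isIrreducible_tilde [FiniteDimensional ℝ L] [CompleteSpace H]
    (hT : T.IsIrreducible) (hinv : T.NoInvariantVectors) : (𝒢.tilde T).IsIrreducible := by
  have hnt : Nontrivial H := hT.1
  refine ⟨?_, fun W hW hWinv => ?_⟩
  · -- A representation in the zero space has no nontrivial cocycles.
    obtain ⟨β, -, hβ⟩ := isSpecial_tilde hinv
    by_contra hcon
    rw [not_nontrivial_iff_subsingleton] at hcon
    exact hβ ⟨0, fun g => Subsingleton.elim _ _⟩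
  by_contra! hcon
  obtain ⟨f, hfW, hf⟩ := W.ne_bot_iff.1 hcon.1
  have : CompleteSpace W := hW.completeSpace_coe
  obtain ⟨g, hgW, hg⟩ := Wᗮ.ne_bot_iff.1 fun h => hcon.2 (W.orthogonal_eq_bot_iff.1 h)
  have h1 := ae_eq_zero_or_of_forall_inner_eq_zero hT hinv (f := f) (g := g) fun x =>
    (W.mem_orthogonal' g).1 hgW _ (hWinv x f hfW)
  have hsupp : ∀ f : Lp H 2 PosReal.haar, MeasurableSet {r | f r ≠ 0} := fun f =>
    (Lp.stronglyMeasurable f).measurableSet_support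
  have hne : ∀ f : Lp H 2 PosReal.haar, PosReal.haar {r | f r ≠ 0} = 0 → f = 0 := fun f h =>
    (Lp.eq_zero_iff_ae_eq_zero).2 h
  rcases PosReal.haar_eq_zero_or (hsupp f) (hsupp g) (fun s => by
    filter_upwards [h1 s] with r hr h2
    exact hr.elim h2.1 h2.2) with h2 | h2
  · exact hf (hne f h2)
  · exact hg (hne g h2)

end LieGrading

theorem mainTheorem12 {L : Type*} [LieRing L] [LieAlgebra ℝ L] [FiniteDimensional ℝ L]
    [LieRing.IsNilpotent L] (𝒢 : LieGrading L)
    {H : Type*} [NormedAddCommGroup H] [InnerProductSpace ℂ H] [CompleteSpace H]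
    (T : UnitaryRep 𝒢.N H) (hT : T.IsIrreducible) (hinv : T.NoInvariantVectors) :
    (∀ u : ℝ → ℝ, ContDiffOn ℝ ∞ u (Set.Ioi 0) → (∀ r, 0 < r → 0 < u r) →
      UnitaryRep.IsAdmissible (UnitaryRep.weightMeasure u) →
      T.IsSummable 𝒢.dilation (UnitaryRep.weightMeasure u)) ∧
    (𝒢.tilde T).IsSpecial ∧ (𝒢.tilde T).IsIrreducible := by
  have : Nontrivial H := hT.1
  exact ⟨fun u _ hu hm => LieGrading.isSummable hinv hm (PosReal.weightMeasure_le_haar hu),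
    LieGrading.isSpecial_tilde hinv, LieGrading.isIrreducible_tilde hT hinv⟩
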